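/- **Setting.** Let $X_1,X_2,\dots$ be i.i.d. uniform on $[0,1]^D$, let $(\epsilon_i)_{i\ge1}$ be a sequence of real random variables independent of $(X_i)$, let $m$ be bounded on $[0,1]^D$, and let $Y_i=m(X_i)+\epsilon_i$. Assume: * *(Banded Cholesky factor)* for fixed $q\in\mathbb N$, a fixed lower-triangular $q\times q$ matrix $\mathbf L$ and fixed $(\rho_0,\dots,\rho_q)$, the $n\times n$ working precision matrix is $\mathbf Q=\mathbf A^\top\mathbf A$, where the first $q$ rows of $\mathbf A$ are $(\mathbf L\;\,0)$ and, for $i>q$, row $i$ has entries $\mathbf A_{ij}=\rho_{i-j}$ for $i-q\le j\le i$ and $0$ otherwise. * *(Diagonal dominance)* there is $\xi>0$ such that for all $n>q$ and all $i$, $\mathbf Q_{ii}-\sum_{j\ne i}|\mathbf Q_{ij}|>\xi$. * *(Tails)* (b) for every $\pi>0$ there are $C_\pi>0$ and $n_0$ such that for all $n>n_0$, with probability at least $1-\pi$, $\max_{i\le n}|\epsilon_i|\le C_\pi\sqrt{\log n}$. (c) For every $\delta>0$ there are $C,c>0$ such that for all $\mathcal I_n\subseteq\{1,\dots,n\}$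 with $a_n=|\mathcal I_n|\to\infty$, $\mathbb P\big(\tfrac1{a_n}|\sum_{i\in\mathcal I_n}\epsilon_i|>\delta\big)\le Ce^{-ca_n}$ for all $n$; and there are $\sigma_0^2,C,c>0$ such that $\mathbb P\big(\tfrac1n\sum_{i\le n}\epsilon_i^2>\sigma_0^2\big)\le Ce^{-cn}$ for all $n$. **Splits.** A split is a pair $(d,c)$ of a direction $d\in\{1,\dots,D\}$ and a cutoff $c\in\mathbb R$; it divides a node $\mathcal C$ into $\mathcal C\cap\{z_d<c\}$ and $\mathcal C\cap\{z_d\ge c\}$. The level-$1$ node is $[0,1]^D$. For $k\ge1$, a split vector $\mathbf s_k$ consists of one split for each node of the levels $1,\dots,k-1$ (each such node is split, so that level $j$ has $2^{j-1}$ nodes) and one last split, applied to the level-$k$ node that contains $\mathbf x$. $\|\mathbf s_k^{(1)}-\mathbf s_k^{(2)}\|_\infty$ is the maximum over all corresponding splits of the differences of directions and of cutoffs. Let $\bar{\mathfrak S}_k^\varepsilon(\mathbf x)$ be the set of $\mathbf s_k$ for which each level-$k$ node contains an (open, axis-parallel) cube of side $\varepsilon$. **Criterion.** For a finite partition with $n$-row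 membership matrix $\mathbf Z$ (one column for each cell that contains an observation), let $\hat{\boldsymbol\beta}(\mathbf Z)=(\mathbf Z^\top\mathbf Q\mathbf Z)^{-1}\mathbf Z^\top\mathbf Q\mathbf Y$. With $\mathbf Z^{(0)}$ and $\mathbf Z$ the membership matrices of the level-$k$ nodes before and after the last split, let $$v_{n,k,\mathbf Q}(\mathbf x,\mathbf s_k)=\tfrac1n\Big[(\mathbf Y-\mathbf Z^{(0)}\hat{\boldsymbol\beta}(\mathbf Z^{(0)}))^\top\mathbf Q(\mathbf Y-\mathbf Z^{(0)}\hat{\boldsymbol\beta}(\mathbf Z^{(0)}))-(\mathbf Y-\mathbf Z\hat{\boldsymbol\beta}(\mathbf Z))^\top\mathbf Q(\mathbf Y-\mathbf Z\hat{\boldsymbol\beta}(\mathbf Z))\Big].$$ **Proposition.** Fix $\mathbf x\in[0,1]^D$, $k\ge1$ and $\varepsilon>0$. For all $\phi,\pi>0$ there is $\delta>0$ such that $$\limsup_{n\to\infty}\mathbb P\Big[\sup\big|v_{n,k,\mathbf Q}(\mathbf x,\mathbf s_k^{(1)})-v_{n,k,\mathbf Q}(\mathbf x,\mathbf s_k^{(2)})\big|>\phi\Big]\le\pi,$$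 where the supremum is over all $\mathbf s_k^{(1)},\mathbf s_k^{(2)}\in\bar{\mathfrak S}_k^\varepsilon(\mathbf x)$ with $\|\mathbf s_k^{(1)}-\mathbf s_k^{(2)}\|_\infty\le\delta$ whose last splits divide the same node, that is, for which $\mathbf x$ lies in the level-$k$ node at the same position of the binary tree. (Probability is outer probability if the event is not measurable.) -/

import Mathlib

open MeasureTheory ProbabilityTheory Filter
open scoped ENNReal Matrix

namespace DART

/-! ### Working precision matrix -/

/-- The `n × n` banded lower-triangular Cholesky factor (rows and columns numbered from `0`).
The first `q` rows carry the fixed `q × q` block `L`; every later row carries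
`(ρ_q, ρ_{q-1}, …, ρ_0)`, ending on the diagonal. -/
noncomputable def choleskyFactor (q : ℕ) (L : Matrix (Fin q) (Fin q) ℝ) (ρ : Fin (q + 1) → ℝ)
    (n : ℕ) : Matrix (Fin n) (Fin n) ℝ :=
  Matrix.of fun i j =>
    if hi : (i : ℕ) < q then
      if hj : (j : ℕ) < q then L ⟨i, hi⟩ ⟨j, hj⟩ else 0
    else if h : (j : ℕ) ≤ i ∧ (i : ℕ) - j ≤ q then ρ ⟨(i : ℕ) - j, Nat.lt_succ_of_le h.2⟩
    else 0

/-- The working precision matrix `Q = Σ^{-T/2} Σ^{-1/2}`. -/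
noncomputable def precision (q : ℕ) (L : Matrix (Fin q) (Fin q) ℝ) (ρ : Fin (q + 1) → ℝ)
    (n : ℕ) : Matrix (Fin n) (Fin n) ℝ :=
  (choleskyFactor q L ρ n)ᵀ * choleskyFactor q L ρ n

/-- Every row of `A` is diagonally dominant with margin greater than `ξ`. -/
def DiagDominant {n : ℕ} (A : Matrix (Fin n) (Fin n) ℝ) (ξ : ℝ) : Prop :=
  ∀ i, ξ < A i i - ∑ j ∈ Finset.univ.erase i, |A i j|

/-! ### Tail behaviour of the errors -/

/-- The maximum of the first `n` absolute errors is of order `√(log n)` in probability. -/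
def LogMaxTail {Ω : Type*} [MeasurableSpace Ω] (μ : Measure Ω) (err : ℕ → Ω → ℝ) : Prop :=
  ∀ π : ℝ, 0 < π → ∃ C : ℝ, 0 < C ∧ ∃ n₀ : ℕ, ∀ n : ℕ, n₀ < n →
    1 - π ≤ μ.real {ω | ∀ i < n, |err i ω| ≤ C * √(Real.log n)}

/-- Exponential concentration of the error averages over growing index sets, for every deviation
`δ`, and exponential control of the mean squared error beyond some level `σ₀²`. -/
def ExpAverageTail {Ω : Type*} [MeasurableSpace Ω] (μ : Measure Ω) (err : ℕ → Ω → ℝ) : Prop :=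
  (∀ δ : ℝ, 0 < δ → ∃ C : ℝ, 0 < C ∧ ∃ c : ℝ, 0 < c ∧
    ∀ I : ℕ → Finset ℕ, (∀ n, I n ⊆ Finset.range n) →
      Tendsto (fun n => (I n).card) atTop atTop →
      ∀ n, μ.real {ω | δ < 1 / ((I n).card : ℝ) * |∑ i ∈ I n, err i ω|}
        ≤ C * Real.exp (-c * (I n).card)) ∧
  (∃ σ₀sq : ℝ, 0 < σ₀sq ∧ ∃ C : ℝ, 0 < C ∧ ∃ c : ℝ, 0 < c ∧
    ∀ n : ℕ, μ.real {ω | σ₀sq < 1 / (n : ℝ) * |∑ i ∈ Finset.range n, err i ω ^ 2|}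
      ≤ C * Real.exp (-c * n))

/-! ### Splits and nodes -/

/-- The feature space `[0,1]^D`. -/
def cube (D : ℕ) : Set (Fin D → ℝ) := Set.Icc 0 1

/-- A split is a pair (direction, cutoff). -/
abbrev Split (D : ℕ) : Type := Fin D × ℝ

/-- The two sides of a split: `false` is `{z | z_d < c}`, `true` is `{z | z_d ≥ c}`. -/
def side {D : ℕ} (s : Split D) : Bool → Set (Fin D → ℝ)
  | false => {z | z s.1 < s.2}
  | true => {z | s.2 ≤ z s.1}

/-- The nodes of the levels `1, …, k - 1` of the binary tree: a node of level `j + 1` is the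
sequence of its `j` left/right (`false`/`true`) turns from the root. -/
abbrev InnerNode (k : ℕ) : Type := (j : Fin (k - 1)) × (Fin (j : ℕ) → Bool)

/-- The nodes of level `k`. -/
abbrev LevelNode (k : ℕ) : Type := Fin (k - 1) → Bool

/-- A vector of splits: one split for every node of the levels `1, …, k - 1`,
and one split of a node of level `k`. -/
structure SplitVector (D k : ℕ) where
  prev : InnerNode k → Split D
  last : Split D

/-- The numerical vector formed by all directions and all cutoffs of a vector of splits. -/
def SplitVector.toVec {D k : ℕ} (s : SplitVector D k) : Option (InnerNode k) → ℝ × ℝ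
  | some a => (((s.prev a).1 : ℕ), (s.prev a).2)
  | none => ((s.last.1 : ℕ), s.last.2)

/-- The sup-norm distance between two vectors of splits. -/
noncomputable def splitDist {D k : ℕ} (s t : SplitVector D k) : ℝ := ‖s.toVec - t.toVec‖

/-- The region of the node `p` of level `k`: the points of `[0,1]^D` which, at each of the
`k - 1` splits met on the way from the root, take the turn recorded in `p`. -/
def cell {D k : ℕ} (s : SplitVector D k) (p : LevelNode k) : Set (Fin D → ℝ) :=
  {z | z ∈ cube D ∧
    ∀ j : Fin (k - 1), z ∈ side (s.prev ⟨j, fun i => p (Fin.castLE j.isLt.le i)⟩) (p j)}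

/-- The region of the node of level `k` that contains `x`. -/
def nodeOf {D k : ℕ} (x : Fin D → ℝ) (s : SplitVector D k) : Set (Fin D → ℝ) :=
  {z | ∃ p : LevelNode k, x ∈ cell s p ∧ z ∈ cell s p}

/-- The partition after the last split: the nodes of level `k` that do not contain `x`, followed
by the two children of the node that does. -/
def childCell {D k : ℕ} (x : Fin D → ℝ) (s : SplitVector D k) :
    {p : LevelNode k // x ∉ cell s p} ⊕ Bool → Set (Fin D → ℝ)
  | Sum.inl p => cell s p
  | Sum.inr b => nodeOf x s ∩ side s.last b

/-- The vectors of splits for which each node of level `k` contains a hypercube of edge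
length `ε`. -/
def wideSplits (D k : ℕ) (ε : ℝ) : Set (SplitVector D k) :=
  {s | ∀ p : LevelNode k, ∃ a : Fin D → ℝ,
    (Set.univ.pi fun d => Set.Ioo (a d) (a d + ε)) ⊆ cell s p}

/-- Both vectors of splits place `x` in the same node of level `k` (same position in the tree),
so that their last splits divide the same node. -/
def SameNode {D k : ℕ} (x : Fin D → ℝ) (s t : SplitVector D k) : Prop :=
  ∀ p : LevelNode k, x ∈ cell s p ↔ x ∈ cell t p

/-! ### The split criterion -/

/-- The membership matrix of the observations `X` in a family `C` of disjoint regions. It has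
one column for each region that contains an observation (an empty region has no GLS coefficient,
and its column would be zero). -/
noncomputable def membership {D n : ℕ} {ι : Type*} (X : Fin n → Fin D → ℝ)
    (C : ι → Set (Fin D → ℝ)) : Matrix (Fin n) {l : ι // ∃ i, X i ∈ C l} ℝ :=
  Matrix.of fun i l => (C l).indicator (fun _ => (1 : ℝ)) (X i)

open Classical in
/-- The GLS estimate `(Zᵀ Q Z)⁻¹ (Zᵀ Q Y)`. -/
noncomputable def glsEstimate {n : ℕ} {ι : Type*} [Fintype ι] (Q : Matrix (Fin n) (Fin n) ℝ)
    (Z : Matrix (Fin n) ι ℝ) (Y : Fin n → ℝ) : ι → ℝ :=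
  (Zᵀ * Q * Z)⁻¹ *ᵥ ((Zᵀ * Q) *ᵥ Y)

/-- The GLS loss `(Y - Z β̂)ᵀ Q (Y - Z β̂)` at the GLS estimate `β̂`. -/
noncomputable def glsLoss {n : ℕ} {ι : Type*} [Fintype ι] (Q : Matrix (Fin n) (Fin n) ℝ)
    (Z : Matrix (Fin n) ι ℝ) (Y : Fin n → ℝ) : ℝ :=
  (Y - Z *ᵥ glsEstimate Q Z Y) ⬝ᵥ (Q *ᵥ (Y - Z *ᵥ glsEstimate Q Z Y))

open Classical in
/-- The empirical DART split criterion for the last split of `s`, which divides the node of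
level `k` containing `x`. -/
noncomputable def dart {D n k : ℕ} (Q : Matrix (Fin n) (Fin n) ℝ) (X : Fin n → Fin D → ℝ)
    (Y : Fin n → ℝ) (x : Fin D → ℝ) (s : SplitVector D k) : ℝ :=
  1 / (n : ℝ) * (glsLoss Q (membership X (cell s)) Y - glsLoss Q (membership X (childCell x s)) Y)

/-- The largest oscillation of the criterion between two vectors of splits of `wideSplits D k ε`
that divide the same node and are at distance at most `δ`. -/
noncomputable def dartModulus {D n : ℕ} (k : ℕ) (Q : Matrix (Fin n) (Fin n) ℝ)
    (X : Fin n → Fin D → ℝ) (Y : Fin n → ℝ) (x : Fin D → ℝ) (ε δ : ℝ) : ℝ≥0∞ :=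
  ⨆ (s ∈ wideSplits D k ε) (t ∈ wideSplits D k ε) (_ : SameNode x s t)
    (_ : splitDist s t ≤ δ), ENNReal.ofReal |dart Q X Y x s - dart Q X Y x t|

end DART

/-! The minimal GLS loss depends only on how the cells label the observations, and the precision
matrix is comparable to the identity: diagonal dominance bounds its quadratic form below by `ξ`, and
the band structure bounds it above by a constant free of `n`. Every level-`k` node contains a cube
of side `ε`, so by the law of large numbers it holds a fixed share of the sample, and its fitted
coefficient is bounded. Two split vectors at distance `δ` disagree only on finitely many slabs of
width `δ`, hence on a small share of the sample. When all occupied cells are well populated, the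
optimal coefficients of one labelling compete in the problem of the other, and the losses differ by
a small multiple of `n` (`abs_loss_sub_le`).

The difficulty is that a child of the last split may hold few observations, so that its coefficient
is uncontrolled. In that case the gain itself is small for both split vectors. It is at most `2 * x
^ 2 / (ξ * c)`, where `c` is the size of the smaller child and `x` is the sum over it of the
precision-weighted residuals before the split (`loss_sub_loss_refineLabel_le`). For `c` above the
order of `√(n log n)`, concentration of the error averages makes this `O(c)`, a small multiple of
`n`; for smaller `c`, the maximal error alone makes it `o(n)` (`sq_div_card_le`). The dichotomy is
carried out in `GoodSample.abs_dart_sub_le`.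

The concentration has to hold for all children at once, and these depend on the covariates. A child
is cut out by `k` half-spaces, so the sample sees only polynomially many index sets. Each is a
function of the covariates, hence independent of the errors, and for sets of at least `√n`
observations the exponential tail beats their number (`tendsto_measure_box_sums`). The weights of
the precision matrix are removed by writing the Cholesky factor as a convolution, which leaves plain
sums over shifted index sets (`abs_indicator_precision_le`). Of all exceptional events only the
bound on the maximal error keeps a nonvanishing probability, at most `π`. -/

namespace DART

/-! ### Bounds for quadratic forms of symmetric matrices. -/

section QuadraticForm

variable {n : ℕ} {Q : Matrix (Fin n) (Fin n) ℝ}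

/-- The quadratic form `vᵀ Q v`. -/
def quad (Q : Matrix (Fin n) (Fin n) ℝ) (v : Fin n → ℝ) : ℝ := v ⬝ᵥ (Q *ᵥ v)

lemma dotProduct_mulVec_comm (hQ : Q.IsSymm) (u v : Fin n → ℝ) :
    u ⬝ᵥ (Q *ᵥ v) = v ⬝ᵥ (Q *ᵥ u) := by
  rw [Matrix.dotProduct_mulVec, ← Matrix.mulVec_transpose, hQ.eq, dotProduct_comm]

lemma quad_sub (hQ : Q.IsSymm) (u v : Fin n → ℝ) :
    quad Q (u - v) = quad Q u - 2 * (u ⬝ᵥ (Q *ᵥ v)) + quad Q v := by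
  unfold quad
  rw [Matrix.mulVec_sub, sub_dotProduct, dotProduct_sub, dotProduct_sub,
    dotProduct_mulVec_comm hQ v u]
  ring

lemma quad_smul (c : ℝ) (v : Fin n → ℝ) : quad Q (c • v) = c ^ 2 * quad Q v := by
  unfold quad
  rw [Matrix.mulVec_smul, smul_dotProduct, dotProduct_smul]
  simp only [smul_eq_mul]
  ring

/-- Young's inequality for a positive semidefinite quadratic form. -/
lemma quad_sub_le (hQ : Q.IsSymm) (h0 : ∀ v, 0 ≤ quad Q v) {τ : ℝ} (hτ : 0 < τ)
    (u v : Fin n → ℝ) :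
    quad Q (u - v) ≤ (1 + τ) * quad Q u + (1 + 1 / τ) * quad Q v := by
  have h := h0 ((-τ) • u - v)
  rw [quad_sub hQ, quad_smul, smul_dotProduct, smul_eq_mul] at h
  rw [quad_sub hQ]
  have h' : 0 ≤ (1 / τ) * ((-τ) ^ 2 * quad Q u - 2 * (-τ * (u ⬝ᵥ (Q *ᵥ v))) + quad Q v) :=
    mul_nonneg (by positivity) h
  have e : (1 / τ) * ((-τ) ^ 2 * quad Q u - 2 * (-τ * (u ⬝ᵥ (Q *ᵥ v))) + quad Q v)
      = τ * quad Q u + 2 * (u ⬝ᵥ (Q *ᵥ v)) + 1 / τ * quad Q v := by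
    field_simp
    ring
  linarith

lemma abs_mulVec_apply_le {K : ℝ} (hK : ∀ i, ∑ j, |Q i j| ≤ K) {b : ℝ} (hb : 0 ≤ b)
    {v : Fin n → ℝ} (hv : ∀ i, |v i| ≤ b) (i : Fin n) : |(Q *ᵥ v) i| ≤ K * b := by
  calc |(Q *ᵥ v) i| = |∑ j, Q i j * v j| := rfl
    _ ≤ ∑ j, |Q i j * v j| := Finset.abs_sum_le_sum_abs _ _
    _ ≤ ∑ j, |Q i j| * b := by
      refine Finset.sum_le_sum fun j _ => ?_
      rw [abs_mul]
      exact mul_le_mul_of_nonneg_left (hv j) (abs_nonneg _)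
    _ = (∑ j, |Q i j|) * b := by rw [Finset.sum_mul]
    _ ≤ K * b := mul_le_mul_of_nonneg_right (hK i) hb

/-- The sum of a bounded vector over an index set, after applying a matrix with bounded row
sums. -/
lemma abs_indicator_dotProduct_le {K : ℝ} (hK : ∀ i, ∑ j, |Q i j| ≤ K) {b : ℝ} (hb : 0 ≤ b)
    {v : Fin n → ℝ} (hv : ∀ i, |v i| ≤ b) (S : Finset (Fin n)) :
    |(fun i => if i ∈ S then (1 : ℝ) else 0) ⬝ᵥ (Q *ᵥ v)| ≤ K * b * S.card := by
  have : (fun i => if i ∈ S then (1 : ℝ) else 0) ⬝ᵥ (Q *ᵥ v) = ∑ i ∈ S, (Q *ᵥ v) i := by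
    simp [dotProduct, Finset.sum_ite_mem]
  rw [this]
  calc |∑ i ∈ S, (Q *ᵥ v) i| ≤ ∑ i ∈ S, |(Q *ᵥ v) i| := Finset.abs_sum_le_sum_abs _ _
    _ ≤ ∑ _i ∈ S, K * b := Finset.sum_le_sum fun i _ => abs_mulVec_apply_le hK hb hv i
    _ = K * b * S.card := by rw [Finset.sum_const, nsmul_eq_mul]; ring

lemma abs_mul_mul_le (x y a : ℝ) : |x * (a * y)| ≤ |a| * (x ^ 2 + y ^ 2) / 2 := by
  have h : |x| * |y| ≤ (x ^ 2 + y ^ 2) / 2 := by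
    nlinarith [sq_nonneg (|x| - |y|), sq_abs x, sq_abs y]
  calc |x * (a * y)| = |a| * (|x| * |y|) := by rw [abs_mul, abs_mul]; ring
    _ ≤ |a| * ((x ^ 2 + y ^ 2) / 2) := mul_le_mul_of_nonneg_left h (abs_nonneg a)
    _ = _ := by ring

/-- By symmetry the two squares contribute equally. This turns the entrywise bound of
`abs_mul_mul_le` into row sums, for the upper and for the lower bound of the form. -/
lemma sum_abs_sq_swap (hQ : Q.IsSymm) (v : Fin n → ℝ) :
    ∑ i, ∑ j, |Q i j| * (v i ^ 2 + v j ^ 2) / 2 = ∑ i, (∑ j, |Q i j|) * v i ^ 2 := by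
  have h2 : ∑ i, ∑ j, |Q i j| * v j ^ 2 = ∑ i, ∑ j, |Q i j| * v i ^ 2 := by
    rw [Finset.sum_comm]
    refine Finset.sum_congr rfl fun i _ => Finset.sum_congr rfl fun j _ => ?_
    rw [hQ.apply]
  have : ∑ i, ∑ j, |Q i j| * (v i ^ 2 + v j ^ 2) / 2
      = (∑ i, ∑ j, |Q i j| * v i ^ 2 + ∑ i, ∑ j, |Q i j| * v j ^ 2) / 2 := by
    rw [← Finset.sum_add_distrib, Finset.sum_div]
    refine Finset.sum_congr rfl fun i _ => ?_
    rw [← Finset.sum_add_distrib, Finset.sum_div]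
    refine Finset.sum_congr rfl fun j _ => ?_
    ring
  rw [this, h2, add_self_div_two]
  simp_rw [Finset.sum_mul]

lemma quad_eq_sum (v : Fin n → ℝ) : quad Q v = ∑ i, ∑ j, v i * (Q i j * v j) := by
  simp [quad, dotProduct, Matrix.mulVec, Finset.mul_sum]

/-- Schur's test for a symmetric matrix. -/
lemma quad_le (hQ : Q.IsSymm) {K : ℝ} (hK : ∀ i, ∑ j, |Q i j| ≤ K) (v : Fin n → ℝ) :
    quad Q v ≤ K * ∑ i, v i ^ 2 := by
  rw [quad_eq_sum, Finset.mul_sum]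
  calc ∑ i, ∑ j, v i * (Q i j * v j) ≤ ∑ i, ∑ j, |Q i j| * (v i ^ 2 + v j ^ 2) / 2 :=
        Finset.sum_le_sum fun i _ => Finset.sum_le_sum fun j _ =>
          (le_abs_self _).trans (abs_mul_mul_le _ _ _)
    _ = ∑ i, (∑ j, |Q i j|) * v i ^ 2 := sum_abs_sq_swap hQ v
    _ ≤ _ := Finset.sum_le_sum fun i _ => mul_le_mul_of_nonneg_right (hK i) (sq_nonneg _)

/-- A symmetric diagonally dominant matrix is bounded below by its margin. -/
lemma DiagDominant.le_quad {ξ : ℝ} (hd : DiagDominant Q ξ) (hQ : Q.IsSymm) (v : Fin n → ℝ) :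
    ξ * ∑ i, v i ^ 2 ≤ quad Q v := by
  -- On the diagonal `|Q i i|` is added and subtracted, so that the complete row sum of
  -- `sum_abs_sq_swap` can be used.
  have key : ∀ i j, v i * (Q i j * v j) ≥
      (if i = j then (Q i i + |Q i i|) * v i ^ 2 else 0) - |Q i j| * (v i ^ 2 + v j ^ 2) / 2 := by
    intro i j
    split_ifs with h
    · subst h
      nlinarith
    · have := neg_le_of_abs_le (abs_mul_mul_le (v i) (v j) (Q i j))
      linarith
  rw [quad_eq_sum, Finset.mul_sum]
  calc ∑ i, ξ * v i ^ 2 ≤ ∑ i, ((Q i i + |Q i i|) * v i ^ 2 - (∑ j, |Q i j|) * v i ^ 2) := by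
        refine Finset.sum_le_sum fun i _ => ?_
        rw [← sub_mul]
        refine mul_le_mul_of_nonneg_right ?_ (sq_nonneg _)
        have h := hd i
        rw [← Finset.add_sum_erase _ _ (Finset.mem_univ i)]
        linarith
    _ = ∑ i, ∑ j, ((if i = j then (Q i i + |Q i i|) * v i ^ 2 else 0)
          - |Q i j| * (v i ^ 2 + v j ^ 2) / 2) := by
        simp only [Finset.sum_sub_distrib]
        rw [sum_abs_sq_swap hQ]
        simp
    _ ≤ _ := Finset.sum_le_sum fun i _ => Finset.sum_le_sum fun j _ => key i j

end QuadraticForm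

/-! ### The GLS loss as a least-squares problem over labellings. -/

section Loss

variable {n : ℕ} {Q : Matrix (Fin n) (Fin n) ℝ}

/-- The GLS loss is the least value of the quadratic form over all coefficient vectors. -/
lemma glsLoss_isLeast {ι : Type*} [Fintype ι] (hQ : Q.IsSymm) (hpos : ∀ v, v ≠ 0 → 0 < quad Q v)
    {Z : Matrix (Fin n) ι ℝ} (hZ : Function.Injective Z.mulVec) (Y : Fin n → ℝ) :
    IsLeast (Set.range fun β : ι → ℝ => quad Q (Y - Z *ᵥ β)) (glsLoss Q Z Y) := by
  classical
  refine ⟨⟨glsEstimate Q Z Y, rfl⟩, ?_⟩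
  rintro _ ⟨β, rfl⟩
  -- A vector in the kernel of the normal matrix has zero quadratic form at `Z *ᵥ v`; positivity and
  -- injectivity make it vanish.
  have hunit : IsUnit (Zᵀ * Q * Z) := by
    rw [← Matrix.mulVec_injective_iff_isUnit]
    rw [← Matrix.coe_mulVecLin, ← LinearMap.ker_eq_bot, LinearMap.ker_eq_bot']
    intro v hv
    rw [Matrix.mulVecLin_apply] at hv
    by_contra hne
    have hZv : Z *ᵥ v ≠ 0 := fun h => hne (hZ (by simpa using h))
    have h1 := hpos _ hZv
    have h2 : quad Q (Z *ᵥ v) = v ⬝ᵥ ((Zᵀ * Q * Z) *ᵥ v) := by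
      unfold quad
      rw [← Matrix.mulVec_mulVec, ← Matrix.mulVec_mulVec, Matrix.dotProduct_mulVec v,
        Matrix.vecMul_transpose]
    rw [h2, hv, dotProduct_zero] at h1
    exact lt_irrefl _ h1
  have hdet := (Matrix.isUnit_iff_isUnit_det _).1 hunit
  have hnormal : (Zᵀ * Q * Z) *ᵥ glsEstimate Q Z Y = (Zᵀ * Q) *ᵥ Y := by
    unfold glsEstimate
    have hinv : (Zᵀ * Q * Z) * (Zᵀ * Q * Z)⁻¹ = 1 := Matrix.mul_nonsing_inv _ hdet
    rw [Matrix.mulVec_mulVec]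
    convert congrArg (fun M => M *ᵥ ((Zᵀ * Q) *ᵥ Y)) hinv using 1
    rw [Matrix.one_mulVec]
  set γ := glsEstimate Q Z Y with hγ
  have horth : ∀ h : ι → ℝ, (Z *ᵥ h) ⬝ᵥ (Q *ᵥ (Y - Z *ᵥ γ)) = 0 := by
    intro h
    rw [← Matrix.vecMul_transpose, ← Matrix.dotProduct_mulVec, Matrix.mulVec_mulVec,
      Matrix.mulVec_sub, Matrix.mulVec_mulVec, hnormal, sub_self, dotProduct_zero]
  have hsplit : Y - Z *ᵥ β = (Y - Z *ᵥ γ) - Z *ᵥ (β - γ) := by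
    rw [Matrix.mulVec_sub]; abel
  have hnn : ∀ v, 0 ≤ quad Q v := fun v => by
    by_cases hv : v = 0
    · simp [hv, quad]
    · exact (hpos v hv).le
  show quad Q (Y - Z *ᵥ γ) ≤ quad Q (Y - Z *ᵥ β)
  rw [hsplit, quad_sub hQ (Y - Z *ᵥ γ), dotProduct_mulVec_comm hQ, horth]
  have := hnn (Z *ᵥ (β - γ))
  linarith

lemma membership_mulVec {D : ℕ} {ι : Type*} (X : Fin n → Fin D → ℝ) (C : ι → Set (Fin D → ℝ))
    [Fintype {l : ι // ∃ i, X i ∈ C l}]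
    (hdisj : ∀ i l l', X i ∈ C l → X i ∈ C l' → l = l')
    (β : {l : ι // ∃ i, X i ∈ C l} → ℝ) (i : Fin n) (l : ι) (hl : X i ∈ C l) :
    (membership X C *ᵥ β) i = β ⟨l, i, hl⟩ := by
  unfold membership Matrix.mulVec dotProduct
  rw [Finset.sum_eq_single ⟨l, i, hl⟩]
  · simp [hl]
  · intro l' _ hne
    have : X i ∉ C l' := fun h => hne (Subtype.ext (hdisj i _ _ h hl))
    simp [this]
  · simp

/-- The GLS loss of a partition in terms of a labelling of the observations by the cells. -/
lemma glsLoss_membership_isLeast {D : ℕ} {ι κ : Type*} (hQ : Q.IsSymm)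
    (hpos : ∀ v, v ≠ 0 → 0 < quad Q v) (X : Fin n → Fin D → ℝ) (C : ι → Set (Fin D → ℝ))
    [Fintype {l : ι // ∃ i, X i ∈ C l}] (lab : Fin n → κ) (g : ι → κ)
    (hg : Function.Injective g) (hlab : ∀ i l, X i ∈ C l ↔ lab i = g l)
    (hcov : ∀ i, ∃ l, X i ∈ C l) (Y : Fin n → ℝ) :
    IsLeast (Set.range fun β : κ → ℝ => quad Q (Y - β ∘ lab))
      (glsLoss Q (membership X C) Y) := by
  have hdisj : ∀ i l l', X i ∈ C l → X i ∈ C l' → l = l' := fun i l l' h h' =>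
    hg (((hlab i l).1 h).symm.trans ((hlab i l').1 h'))
  have hZ : Function.Injective (membership X C).mulVec := by
    intro β β' h
    funext ⟨l, i, hl⟩
    have := congrFun h i
    rwa [membership_mulVec X C hdisj β i l hl, membership_mulVec X C hdisj β' i l hl] at this
  have hleast := glsLoss_isLeast hQ hpos hZ Y
  convert hleast using 1
  ext y
  constructor
  · rintro ⟨β, rfl⟩
    refine ⟨fun l => β (g l), ?_⟩
    have : membership X C *ᵥ (fun l => β (g l)) = β ∘ lab := by
      funext i
      obtain ⟨l, hl⟩ := hcov i
      rw [membership_mulVec X C hdisj _ i l hl, Function.comp_apply, (hlab i l).1 hl]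
    simp only [this]
  · rintro ⟨β, rfl⟩
    -- Labels without observations receive the coefficient `0`, which never enters `β ∘ lab`.
    -- Different partitions thus share one coefficient space.
    refine ⟨Function.extend (fun l : {l : ι // ∃ i, X i ∈ C l} => g l) β 0, ?_⟩
    have : membership X C *ᵥ β
        = Function.extend (fun l : {l : ι // ∃ i, X i ∈ C l} => g l) β 0 ∘ lab := by
      funext i
      obtain ⟨l, hl⟩ := hcov i
      have hinj : Function.Injective (fun l : {l : ι // ∃ i, X i ∈ C l} => g l) :=
        fun a b h => Subtype.ext (hg h)
      rw [membership_mulVec X C hdisj _ i l hl, Function.comp_apply, (hlab i l).1 hl]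
      exact (hinj.extend_apply β 0 ⟨l, i, hl⟩).symm
    simp only [this]

/-- The residual of a least-squares fit is orthogonal to the fitted space. -/
lemma dotProduct_residual_eq_zero {κ : Type*} (hQ : Q.IsSymm)
    {lab : Fin n → κ} {Y : Fin n → ℝ} {γ : κ → ℝ}
    (hγ : ∀ β : κ → ℝ, quad Q (Y - γ ∘ lab) ≤ quad Q (Y - β ∘ lab)) (h : κ → ℝ) :
    (h ∘ lab) ⬝ᵥ (Q *ᵥ (Y - γ ∘ lab)) = 0 := by
  set r := Y - γ ∘ lab with hr
  set x := (h ∘ lab) ⬝ᵥ (Q *ᵥ r) with hx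
  -- Minimality along the line `γ + t • h`: a nonnegative quadratic in `t` without constant term has
  -- no linear term, which the discriminant expresses.
  have key : ∀ t : ℝ, 0 ≤ quad Q (h ∘ lab) * (t * t) + (-2 * x) * t + 0 := by
    intro t
    have h1 := hγ (γ + t • h)
    have h2 : Y - (γ + t • h) ∘ lab = r - t • (h ∘ lab) := by
      funext i; simp [hr]; ring
    rw [h2, quad_sub hQ r, quad_smul, dotProduct_mulVec_comm hQ, smul_dotProduct, smul_eq_mul,
      ← hx] at h1
    nlinarith
  have := discrim_le_zero key
  unfold discrim at this
  nlinarith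

/-- Young's inequality with parameter `1`, since the fit is the response minus the residual. -/
lemma quad_fit_le {κ : Type*} (hQ : Q.IsSymm) (h0 : ∀ v, 0 ≤ quad Q v)
    {lab : Fin n → κ} {Y : Fin n → ℝ} {γ : κ → ℝ}
    (hγ : quad Q (Y - γ ∘ lab) ≤ quad Q Y) : quad Q (γ ∘ lab) ≤ 4 * quad Q Y := by
  have h := quad_sub_le hQ h0 one_pos Y (Y - γ ∘ lab)
  rw [sub_sub_cancel] at h
  linarith

/-- The coefficient of a cell that contains a positive share of the observations is bounded. -/
lemma coeff_sq_le {κ : Type*} [DecidableEq κ] (hQ : Q.IsSymm) {ξ K B η : ℝ} (hξ : 0 < ξ)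
    (hη : 0 < η) (hn : 0 < n) (hlow : ∀ v, ξ * ∑ i, v i ^ 2 ≤ quad Q v)
    (hup : ∀ v, quad Q v ≤ K * ∑ i, v i ^ 2) (hK : 0 ≤ K)
    {lab : Fin n → κ} {Y : Fin n → ℝ} {γ : κ → ℝ} (hY : ∑ i, Y i ^ 2 ≤ B * n)
    (hγ : quad Q (Y - γ ∘ lab) ≤ quad Q Y) {l : κ}
    (hl : η * n ≤ (Finset.univ.filter fun i => lab i = l).card) :
    γ l ^ 2 ≤ 4 * K * B / (ξ * η) := by
  have h0 : ∀ v, 0 ≤ quad Q v := fun v =>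
    (mul_nonneg hξ.le (Finset.sum_nonneg fun i _ => sq_nonneg _)).trans (hlow v)
  have hn' : (0 : ℝ) < n := by exact_mod_cast hn
  have h1 := quad_fit_le hQ h0 hγ
  have h2 := hlow (γ ∘ lab)
  have h3 := hup Y
  have h4 : (Finset.univ.filter fun i => lab i = l).card * γ l ^ 2
      ≤ ∑ i, (γ ∘ lab) i ^ 2 := by
    calc ((Finset.univ.filter fun i => lab i = l).card : ℝ) * γ l ^ 2
        = ∑ i ∈ Finset.univ.filter fun i => lab i = l, (γ ∘ lab) i ^ 2 := by
          rw [Finset.sum_congr rfl (g := fun _ => γ l ^ 2), Finset.sum_const, nsmul_eq_mul]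
          intro i hi
          simp only [Finset.mem_filter] at hi
          simp [hi.2]
      _ ≤ _ := Finset.sum_le_sum_of_subset_of_nonneg (Finset.filter_subset _ _)
          fun i _ _ => sq_nonneg _
  have h5 : η * n * γ l ^ 2 ≤ ∑ i, (γ ∘ lab) i ^ 2 :=
    (mul_le_mul_of_nonneg_right hl (sq_nonneg _)).trans h4
  have h6 : ξ * (η * n * γ l ^ 2) ≤ 4 * (K * (B * n)) := by
    have := mul_le_mul_of_nonneg_left h5 hξ.le
    have := mul_le_mul_of_nonneg_left hY hK
    linarith
  rw [le_div_iff₀ (by positivity)]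
  have h7 : (γ l ^ 2 * (ξ * η)) * n ≤ (4 * K * B) * n := by linarith
  exact le_of_mul_le_mul_right h7 hn'

/-- Changing the labels of few observations changes the loss little, as long as the
coefficients are bounded. -/
lemma loss_le_of_agree {κ : Type*} [DecidableEq κ] (hQ : Q.IsSymm) (h0 : ∀ v, 0 ≤ quad Q v)
    {K b τ L L' : ℝ} (hτ : 0 < τ) (hup : ∀ v, quad Q v ≤ K * ∑ i, v i ^ 2) (hK : 0 ≤ K)
    {lab lab' : Fin n → κ} {Y : Fin n → ℝ} {γ : κ → ℝ} (hγ : quad Q (Y - γ ∘ lab) = L)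
    (hL' : ∀ β : κ → ℝ, L' ≤ quad Q (Y - β ∘ lab'))
    (hb : ∀ i, γ (lab i) ^ 2 ≤ b) (hb' : ∀ i, γ (lab' i) ^ 2 ≤ b) :
    L' ≤ (1 + τ) * L + (1 + 1 / τ) *
      (K * (4 * b * (Finset.univ.filter fun i => lab i ≠ lab' i).card)) := by
  refine (hL' γ).trans ?_
  have e : Y - γ ∘ lab' = (Y - γ ∘ lab) - (γ ∘ lab' - γ ∘ lab) := by abel
  rw [e]
  refine (quad_sub_le hQ h0 hτ _ _).trans ?_
  rw [hγ]
  have h1 : ∑ i, (γ ∘ lab' - γ ∘ lab) i ^ 2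
      ≤ 4 * b * (Finset.univ.filter fun i => lab i ≠ lab' i).card := by
    rw [mul_comm, ← nsmul_eq_mul, ← Finset.sum_const, Finset.sum_filter]
    refine Finset.sum_le_sum fun i _ => ?_
    split_ifs with h
    · simp only [Pi.sub_apply, Function.comp_apply]
      nlinarith [hb i, hb' i, sq_nonneg (γ (lab' i) + γ (lab i))]
    · push Not at h
      simp [h]
  have h2 := (hup (γ ∘ lab' - γ ∘ lab)).trans (mul_le_mul_of_nonneg_left h1 hK)
  have h3 : 0 ≤ 1 + 1 / τ := by positivity
  have := mul_le_mul_of_nonneg_left h2 h3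
  linarith

/-- The labels after the cell `p₀` has been divided in two according to `bit`. -/
def refineLabel {κ : Type*} [DecidableEq κ] (lab : Fin n → κ) (p₀ : κ) (bit : Fin n → Bool)
    (i : Fin n) : κ × Bool :=
  -- Outside `p₀` the second component is `false`, so the labels `(p, true)` with `p ≠ p₀` are never
  -- taken.
  (lab i, decide (lab i = p₀) && bit i)

/-- Coefficients of the coarse partition remain admissible on the refined one. -/
lemma loss_refineLabel_le {κ : Type*} [DecidableEq κ] {lab : Fin n → κ} {p₀ : κ} {bit : Fin n → Bool}
    {Y : Fin n → ℝ} {L₀ L : ℝ}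
    (hL₀ : IsLeast (Set.range fun β : κ → ℝ => quad Q (Y - β ∘ lab)) L₀)
    (hL : IsLeast (Set.range fun β : κ × Bool → ℝ => quad Q (Y - β ∘ refineLabel lab p₀ bit)) L) :
    L ≤ L₀ := by
  obtain ⟨γ, rfl⟩ := hL₀.1
  exact hL.2 ⟨γ ∘ Prod.fst, rfl⟩

/-- The gain from dividing a cell is controlled by the weighted residual sum over the smaller
of the two children. -/
lemma loss_sub_loss_refineLabel_le {κ : Type*} [DecidableEq κ] (hQ : Q.IsSymm) {ξ : ℝ} (hξ : 0 < ξ)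
    (hlow : ∀ v, ξ * ∑ i, v i ^ 2 ≤ quad Q v)
    {lab : Fin n → κ} {p₀ : κ} {bit : Fin n → Bool} {Y : Fin n → ℝ} {L : ℝ} {γ : κ → ℝ}
    (hγ : ∀ β : κ → ℝ, quad Q (Y - γ ∘ lab) ≤ quad Q (Y - β ∘ lab))
    (hL : IsLeast (Set.range fun β : κ × Bool → ℝ => quad Q (Y - β ∘ refineLabel lab p₀ bit)) L)
    {b : Bool} {S S' : Finset (Fin n)}
    (hS : S = Finset.univ.filter fun i => refineLabel lab p₀ bit i = (p₀, b))
    (hS' : S' = Finset.univ.filter fun i => refineLabel lab p₀ bit i = (p₀, !b))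
    (hcard : S.card ≤ S'.card) :
    quad Q (Y - γ ∘ lab) - L ≤
      2 * ((fun i => if i ∈ S then (1 : ℝ) else 0) ⬝ᵥ (Q *ᵥ (Y - γ ∘ lab))) ^ 2
        / (ξ * S.card) := by
  have h0 : ∀ v, 0 ≤ quad Q v := fun v =>
    (mul_nonneg hξ.le (Finset.sum_nonneg fun i _ => sq_nonneg _)).trans (hlow v)
  obtain ⟨β, rfl⟩ := hL.1
  set e : Fin n → ℝ := fun i => if i ∈ S then (1 : ℝ) else 0 with he
  set r := Y - γ ∘ lab with hr
  set x := e ⬝ᵥ (Q *ᵥ r) with hx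
  -- The change of fit `g` is a function of the coarse cell plus a multiple of the indicator of the
  -- smaller child. In the divided cell the larger child serves as the base; orthogonality of the
  -- residual then removes `h`.
  set h : κ → ℝ := fun p => β (p, if p = p₀ then !b else false) - γ p with hh
  set τ := β (p₀, b) - β (p₀, !b) with hτ
  set g : Fin n → ℝ := h ∘ lab + τ • e with hg
  have hmem : ∀ i, i ∈ S ↔ refineLabel lab p₀ bit i = (p₀, b) := fun i => by simp [hS]
  have hmem' : ∀ i, i ∈ S' ↔ refineLabel lab p₀ bit i = (p₀, !b) := fun i => by simp [hS']
  have hval : ∀ i, g i = β (refineLabel lab p₀ bit i) - γ (lab i) := by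
    intro i
    simp only [hg, Pi.add_apply, Pi.smul_apply, smul_eq_mul, Function.comp_apply, hh, he, hmem]
    by_cases hp : lab i = p₀
    · cases b <;> cases hbit : bit i <;> simp [refineLabel, hp, hbit, hτ]
    · simp [refineLabel, hp]
  have hsplit : Y - β ∘ refineLabel lab p₀ bit = r - g := by
    funext i
    simp only [hr, Pi.sub_apply, Function.comp_apply, hval]
    ring
  have horth : g ⬝ᵥ (Q *ᵥ r) = τ * x := by
    rw [hg, add_dotProduct, smul_dotProduct, smul_eq_mul,
      dotProduct_residual_eq_zero hQ hγ h, zero_add]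
  -- The values of `g` on the two children differ by `τ`, so their squares sum to at least `τ ^ 2 /
  -- 2`. As `S` is the smaller child, both squares occur at least `S.card` times.
  have hsq : (S.card : ℝ) * (τ ^ 2 / 2) ≤ ∑ i, g i ^ 2 := by
    set a := β (p₀, !b) - γ p₀ with ha
    set a' := β (p₀, b) - γ p₀ with ha'
    have hdisj : Disjoint S S' := by
      rw [Finset.disjoint_left]
      intro i h1 h2
      rw [hmem] at h1
      rw [hmem', h1] at h2
      cases b <;> simp at h2
    have hlabS : ∀ i ∈ S, g i ^ 2 = a' ^ 2 := by
      intro i hi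
      rw [hmem] at hi
      have : lab i = p₀ := congrArg Prod.fst hi
      rw [hval, hi, this]
    have hlabS' : ∀ i ∈ S', g i ^ 2 = a ^ 2 := by
      intro i hi
      rw [hmem'] at hi
      have : lab i = p₀ := congrArg Prod.fst hi
      rw [hval, hi, this]
    have h1 : ∑ i ∈ S ∪ S', g i ^ 2 ≤ ∑ i, g i ^ 2 :=
      Finset.sum_le_sum_of_subset_of_nonneg (Finset.subset_univ _) fun i _ _ => sq_nonneg _
    rw [Finset.sum_union hdisj, Finset.sum_congr rfl hlabS, Finset.sum_congr rfl hlabS',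
      Finset.sum_const, Finset.sum_const, nsmul_eq_mul, nsmul_eq_mul] at h1
    have h2 : (S.card : ℝ) * a ^ 2 ≤ S'.card * a ^ 2 :=
      mul_le_mul_of_nonneg_right (by exact_mod_cast hcard) (sq_nonneg _)
    have h3 : τ ^ 2 / 2 ≤ a' ^ 2 + a ^ 2 := by
      have : τ = a' - a := by simp only [hτ, ha, ha']; ring
      rw [this]
      nlinarith [sq_nonneg (a + a')]
    have h4 := mul_le_mul_of_nonneg_left h3 (Nat.cast_nonneg (α := ℝ) S.card)
    linarith
  show quad Q r - quad Q (Y - β ∘ refineLabel lab p₀ bit) ≤ _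
  rw [hsplit, quad_sub hQ r, dotProduct_mulVec_comm hQ, horth]
  have hlow' := (mul_le_mul_of_nonneg_left hsq hξ.le).trans (hlow g)
  rcases Nat.eq_zero_or_pos S.card with hc | hc
  · have hS0 : S = ∅ := Finset.card_eq_zero.1 hc
    have hx0 : x = 0 := by
      simp [hx, he, hS0, dotProduct]
    have := h0 g
    simp only [hx0, hc]
    simp
    linarith
  · have hc' : (0 : ℝ) < S.card := by exact_mod_cast hc
    rw [le_div_iff₀ (by positivity)]
    have hpos : 0 < ξ * S.card := by positivity
    have h5 : quad Q r - (quad Q r - 2 * (τ * x) + quad Q g)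
        ≤ 2 * (τ * x) - ξ * (S.card * (τ ^ 2 / 2)) := by linarith
    refine (mul_le_mul_of_nonneg_right h5 hpos.le).trans ?_
    -- The bound is the maximum over `τ` of `2 * τ * x - ξ * S.card * τ ^ 2 / 2`, attained where
    -- this square vanishes.
    nlinarith [sq_nonneg (ξ * S.card * τ - 2 * x)]

end Loss

/-! ### The tree of nodes and its stability under small changes of the splits. -/

section Cells

variable {D k : ℕ}

lemma mem_side_false {s : Split D} {z : Fin D → ℝ} : z ∈ side s false ↔ z s.1 < s.2 := Iff.rfl

lemma mem_side_true {s : Split D} {z : Fin D → ℝ} : z ∈ side s true ↔ s.2 ≤ z s.1 := Iff.rfl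

lemma exists_mem_side (s : Split D) (z : Fin D → ℝ) : ∃ b, z ∈ side s b := by
  rcases lt_or_ge (z s.1) s.2 with h | h
  · exact ⟨false, h⟩
  · exact ⟨true, h⟩

lemma side_unique {s : Split D} {z : Fin D → ℝ} {b b' : Bool} (h : z ∈ side s b)
    (h' : z ∈ side s b') : b = b' := by
  cases b <;> cases b' <;> simp only [mem_side_false, mem_side_true] at h h' <;>
    first | rfl | exact absurd h (not_lt.2 h') | exact absurd h' (not_lt.2 h)

/-- The split met at a level is determined by the earlier turns, so agreement propagates down the
tree. -/
lemma cell_unique {s : SplitVector D k} {z : Fin D → ℝ} {p p' : LevelNode k}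
    (h : z ∈ cell s p) (h' : z ∈ cell s p') : p = p' := by
  funext ⟨j, hj⟩
  induction j using Nat.strong_induction_on with
  | _ j ih =>
    have h1 := h.2 ⟨j, hj⟩
    have h2 := h'.2 ⟨j, hj⟩
    have e : (fun i : Fin j => p (Fin.castLE hj.le i)) = fun i => p' (Fin.castLE hj.le i) := by
      funext i
      exact ih i i.2 _
    simp only at h1 h2
    rw [e] at h1
    exact side_unique h1 h2

lemma exists_mem_cell (s : SplitVector D k) {z : Fin D → ℝ} (hz : z ∈ cube D) :
    ∃ p, z ∈ cell s p := by
  have key : ∀ m : ℕ, m ≤ k - 1 → ∃ p : LevelNode k, ∀ j : Fin (k - 1), (j : ℕ) < m →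
      z ∈ side (s.prev ⟨j, fun i => p (Fin.castLE j.isLt.le i)⟩) (p j) := by
    intro m
    induction m with
    | zero => exact fun _ => ⟨fun _ => false, fun j hj => absurd hj (Nat.not_lt_zero _)⟩
    | succ m ih =>
      intro hm
      obtain ⟨p, hp⟩ := ih (by omega)
      obtain ⟨b, hb⟩ := exists_mem_side
        (s.prev ⟨⟨m, hm⟩, fun i => p (Fin.castLE (Nat.le_of_succ_le hm) i)⟩) z
      -- Changing turn `m` affects none of the splits met up to and including that turn, since each
      -- depends on strictly earlier turns only.
      have hold : ∀ j : Fin (k - 1), (j : ℕ) ≤ m →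
          (fun i : Fin j => Function.update p ⟨m, hm⟩ b (Fin.castLE j.isLt.le i))
            = fun i => p (Fin.castLE j.isLt.le i) := by
        intro j hj
        funext i
        refine Function.update_of_ne (fun h => ?_) _ _
        have h' := congrArg Fin.val h
        simp only [Fin.val_castLE] at h'
        have := i.2
        omega
      refine ⟨Function.update p ⟨m, hm⟩ b, fun j hj => ?_⟩
      rw [hold j (by omega)]
      rcases Nat.lt_succ_iff_lt_or_eq.1 hj with h | h
      · rw [Function.update_of_ne (fun e => by simp [e] at h)]
        exact hp j h
      · obtain rfl : j = ⟨m, hm⟩ := Fin.ext h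
        rw [Function.update_self]
        exact hb
  obtain ⟨p, hp⟩ := key (k - 1) le_rfl
  exact ⟨p, hz, fun j => hp j j.2⟩

/-- The node of level `k` that contains a point of the cube. -/
noncomputable def cellLabel (s : SplitVector D k) (z : Fin D → ℝ) : LevelNode k :=
  Classical.epsilon fun p => z ∈ cell s p

lemma mem_cell_cellLabel (s : SplitVector D k) {z : Fin D → ℝ} (hz : z ∈ cube D) :
    z ∈ cell s (cellLabel s z) :=
  Classical.epsilon_spec (exists_mem_cell s hz)

lemma mem_cell_iff (s : SplitVector D k) {z : Fin D → ℝ} (hz : z ∈ cube D) (p : LevelNode k) :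
    z ∈ cell s p ↔ cellLabel s z = p :=
  ⟨fun h => cell_unique (mem_cell_cellLabel s hz) h, fun h => h ▸ mem_cell_cellLabel s hz⟩

lemma nodeOf_eq (s : SplitVector D k) {x : Fin D → ℝ} (hx : x ∈ cube D) :
    nodeOf x s = cell s (cellLabel s x) := by
  ext z
  constructor
  · rintro ⟨p, hp, hz⟩
    rwa [(mem_cell_iff s hx p).1 hp]
  · exact fun hz => ⟨_, mem_cell_cellLabel s hx, hz⟩

/-- The side of the last split on which a point lies. -/
noncomputable def lastBit (s : SplitVector D k) (z : Fin D → ℝ) : Bool :=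
  open Classical in decide (s.last.2 ≤ z s.last.1)

lemma mem_side_last_iff (s : SplitVector D k) (z : Fin D → ℝ) (b : Bool) :
    z ∈ side s.last b ↔ lastBit s z = b := by
  cases b <;> simp [mem_side_false, mem_side_true, lastBit]

/-- The slab of width `δ` above the cutoff `c` in direction `d`. -/
def slab (d : Fin D) (c δ : ℝ) : Set (Fin D → ℝ) := {z | z d ∈ Set.Icc c (c + δ)}

/-- Two parallel splits disagree only between their cutoffs. -/
lemma mem_slab_of_side {s t : Split D} {δ : ℝ} (hd : s.1 = t.1) (hc : |s.2 - t.2| ≤ δ)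
    {z : Fin D → ℝ} (h : ¬ (s.2 ≤ z s.1 ↔ t.2 ≤ z t.1)) :
    z ∈ slab s.1 (min s.2 t.2) δ := by
  rw [← hd] at h
  have hc' := abs_le.1 hc
  show min s.2 t.2 ≤ z s.1 ∧ z s.1 ≤ min s.2 t.2 + δ
  rcases le_total s.2 t.2 with hst | hst
  · rw [min_eq_left hst]
    by_cases h1 : s.2 ≤ z s.1
    · have h2 : ¬ t.2 ≤ z s.1 := fun h2 => h ⟨fun _ => h2, fun _ => h1⟩
      exact ⟨h1, by linarith⟩
    · exact absurd ⟨fun h2 => absurd h2 h1, fun h2 => hst.trans h2⟩ h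
  · rw [min_eq_right hst]
    by_cases h1 : t.2 ≤ z s.1
    · have h2 : ¬ s.2 ≤ z s.1 := fun h2 => h ⟨fun _ => h1, fun _ => h2⟩
      exact ⟨h1, by linarith⟩
    · exact absurd ⟨fun h2 => hst.trans h2, fun h2 => absurd h2 h1⟩ h

lemma toVec_close {s t : SplitVector D k} {δ : ℝ} (h : splitDist s t ≤ δ)
    (a : Option (InnerNode k)) :
    |(s.toVec a).1 - (t.toVec a).1| ≤ δ ∧ |(s.toVec a).2 - (t.toVec a).2| ≤ δ := by
  have h1 : ‖(s.toVec - t.toVec) a‖ ≤ δ := (norm_le_pi_norm _ a).trans h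
  rw [Pi.sub_apply, Prod.norm_def] at h1
  exact ⟨(le_max_left _ _).trans h1, (le_max_right _ _).trans h1⟩

/-- Directions are integers. Split vectors at distance below `1` therefore share all directions and
differ in their cutoffs only. -/
lemma direction_eq_of_abs_lt {d d' : Fin D} (h : |((d : ℕ) : ℝ) - ((d' : ℕ) : ℝ)| < 1) :
    d = d' := by
  have h' : |((d : ℕ) : ℤ) - ((d' : ℕ) : ℤ)| < 1 := by exact_mod_cast h
  rw [Int.abs_lt_one_iff] at h'
  exact Fin.ext (by omega)

lemma prev_close {s t : SplitVector D k} {δ : ℝ} (hδ : δ < 1) (h : splitDist s t ≤ δ)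
    (a : InnerNode k) :
    (s.prev a).1 = (t.prev a).1 ∧ |(s.prev a).2 - (t.prev a).2| ≤ δ := by
  have := toVec_close h (some a)
  exact ⟨direction_eq_of_abs_lt (this.1.trans_lt hδ), this.2⟩

lemma last_close {s t : SplitVector D k} {δ : ℝ} (hδ : δ < 1) (h : splitDist s t ≤ δ) :
    s.last.1 = t.last.1 ∧ |s.last.2 - t.last.2| ≤ δ := by
  have := toVec_close h none
  exact ⟨direction_eq_of_abs_lt (this.1.trans_lt hδ), this.2⟩

lemma mem_side_congr {s t : Split D} {z : Fin D → ℝ} (h : s.2 ≤ z s.1 ↔ t.2 ≤ z t.1) (b : Bool) :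
    z ∈ side s b ↔ z ∈ side t b := by
  cases b
  · rw [mem_side_false, mem_side_false, ← not_le, ← not_le, h]
  · exact h

/-- Points that change node between two close vectors of splits lie in one of finitely many
thin slabs. -/
lemma exists_mem_slab_of_cellLabel_ne {s t : SplitVector D k} {δ : ℝ} (hδ : δ < 1)
    (h : splitDist s t ≤ δ) {z : Fin D → ℝ} (hne : cellLabel s z ≠ cellLabel t z) :
    ∃ a, z ∈ slab (s.prev a).1 (min (s.prev a).2 (t.prev a).2) δ := by
  by_contra hno
  push Not at hno
  apply hne
  have key : ∀ a, (s.prev a).2 ≤ z (s.prev a).1 ↔ (t.prev a).2 ≤ z (t.prev a).1 := by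
    intro a
    by_contra hc
    exact hno a (mem_slab_of_side (prev_close hδ h a).1 (prev_close hδ h a).2 hc)
  have hcell : (fun p => z ∈ cell s p) = fun p => z ∈ cell t p := by
    funext p
    refine propext (and_congr Iff.rfl (forall_congr' fun j => ?_))
    exact mem_side_congr (key _) _
  -- Equal predicates yield the same epsilon choice, so `z` need not lie in the cube.
  unfold cellLabel
  rw [hcell]

lemma mem_slab_of_lastBit_ne {s t : SplitVector D k} {δ : ℝ} (hδ : δ < 1)
    (h : splitDist s t ≤ δ) {z : Fin D → ℝ} (hne : lastBit s z ≠ lastBit t z) :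
    z ∈ slab s.last.1 (min s.last.2 t.last.2) δ := by
  refine mem_slab_of_side (last_close hδ h).1 (last_close hδ h).2 fun hc => hne ?_
  unfold lastBit
  simp only [hc]

lemma cellLabel_eq_of_sameNode {s t : SplitVector D k} {x : Fin D → ℝ} (hx : x ∈ cube D)
    (h : SameNode x s t) : cellLabel s x = cellLabel t x :=
  ((mem_cell_iff t hx _).1 ((h _).1 (mem_cell_cellLabel s hx))).symm

end Cells

/-! ### The losses before and after the last split, in terms of labels. -/

section LossOfSplits

variable {D n k : ℕ} {Q : Matrix (Fin n) (Fin n) ℝ}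

/-- The loss before the last split as a least squares problem over the node labels. -/
lemma glsLoss_cell_isLeast (hQ : Q.IsSymm) (hpos : ∀ v, v ≠ 0 → 0 < quad Q v)
    {X : Fin n → Fin D → ℝ} (hX : ∀ i, X i ∈ cube D) (Y : Fin n → ℝ) (s : SplitVector D k)
    [Fintype {l : LevelNode k // ∃ i, X i ∈ cell s l}] :
    IsLeast (Set.range fun β : LevelNode k → ℝ => quad Q (Y - β ∘ fun i => cellLabel s (X i)))
      (glsLoss Q (membership X (cell s)) Y) :=
  glsLoss_membership_isLeast hQ hpos X (cell s) _ id Function.injective_id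
    (fun i l => mem_cell_iff s (hX i) l) (fun i => exists_mem_cell s (hX i)) Y

/-- The labels of the observations after the last split. -/
noncomputable def childLabel (X : Fin n → Fin D → ℝ) (x : Fin D → ℝ) (s : SplitVector D k) :
    Fin n → LevelNode k × Bool :=
  refineLabel (fun i => cellLabel s (X i)) (cellLabel s x) fun i => lastBit s (X i)

/-- The loss after the last split as a least squares problem over the refined labels. -/
lemma glsLoss_childCell_isLeast (hQ : Q.IsSymm) (hpos : ∀ v, v ≠ 0 → 0 < quad Q v)
    {X : Fin n → Fin D → ℝ} (hX : ∀ i, X i ∈ cube D) (Y : Fin n → ℝ) {x : Fin D → ℝ}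
    (hx : x ∈ cube D) (s : SplitVector D k)
    [Fintype {l : {p : LevelNode k // x ∉ cell s p} ⊕ Bool // ∃ i, X i ∈ childCell x s l}] :
    IsLeast (Set.range fun β : LevelNode k × Bool → ℝ => quad Q (Y - β ∘ childLabel X x s))
      (glsLoss Q (membership X (childCell x s)) Y) := by
  have hx' : ∀ p, x ∉ cell s p ↔ cellLabel s x ≠ p := fun p => not_congr (mem_cell_iff s hx p)
  refine glsLoss_membership_isLeast hQ hpos X (childCell x s) _
    (Sum.elim (fun p => (p.1, false)) fun b => (cellLabel s x, b)) ?_ ?_ ?_ Y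
  · rintro (⟨p, hp⟩ | b) (⟨p', hp'⟩ | b') h
    · simpa using h
    · simp only [Sum.elim_inl, Sum.elim_inr, Prod.mk.injEq] at h
      exact absurd h.1.symm ((hx' p).1 hp)
    · simp only [Sum.elim_inl, Sum.elim_inr, Prod.mk.injEq] at h
      exact absurd h.1 ((hx' p').1 hp')
    · simpa using h
  · rintro i (⟨p, hp⟩ | b)
    · show X i ∈ cell s p ↔ _
      rw [mem_cell_iff s (hX i)]
      simp only [childLabel, refineLabel, Sum.elim_inl, Prod.mk.injEq]
      constructor
      · intro h
        have : cellLabel s (X i) ≠ cellLabel s x := h ▸ ((hx' p).1 hp).symm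
        exact ⟨h, by simp [this]⟩
      · exact fun h => h.1
    · show X i ∈ nodeOf x s ∩ side s.last b ↔ _
      rw [nodeOf_eq s hx, Set.mem_inter_iff, mem_cell_iff s (hX i), mem_side_last_iff]
      simp only [childLabel, refineLabel, Sum.elim_inr, Prod.mk.injEq]
      refine and_congr_right fun h => ?_
      simp [h]
  · intro i
    by_cases h : cellLabel s (X i) = cellLabel s x
    · refine ⟨Sum.inr (lastBit s (X i)), ?_⟩
      show X i ∈ nodeOf x s ∩ side s.last _
      rw [nodeOf_eq s hx, Set.mem_inter_iff, mem_cell_iff s (hX i), mem_side_last_iff]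
      exact ⟨h, rfl⟩
    · exact ⟨Sum.inl ⟨cellLabel s (X i), (hx' _).2 (Ne.symm h)⟩, mem_cell_cellLabel s (hX i)⟩

end LossOfSplits

/-! ### Reduction of cubes and slabs to a finite grid. -/

section Grid

variable {D : ℕ}

/-- The closed cubes of the regular grid of mesh `1 / N`. -/
def gridCube (N : ℕ) (j : Fin D → Fin N) : Set (Fin D → ℝ) :=
  Set.Icc (fun d => (j d : ℕ) / (N : ℝ)) fun d => ((j d : ℕ) + 1) / (N : ℝ)

/-- A cube of side `ε` inside the unit cube contains a grid cube of mesh less than `ε / 2`. -/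
lemma exists_gridCube_subset {N : ℕ} {ε : ℝ} (hN : 2 < ε * N) {a : Fin D → ℝ}
    (ha : (Set.univ.pi fun d => Set.Ioo (a d) (a d + ε)) ⊆ cube D) :
    ∃ j : Fin D → Fin N,
      gridCube N j ⊆ Set.univ.pi fun d => Set.Ioo (a d) (a d + ε) := by
  have hN0 : (0 : ℝ) < N := by
    rcases Nat.eq_zero_or_pos N with h | h
    · simp [h] at hN; linarith
    · exact_mod_cast h
  -- The first grid point strictly beyond `a d`. The next one is at most `a d + 2 / N`, which is
  -- less than `a d + ε`.
  set J : Fin D → ℤ := fun d => ⌊a d * N⌋ + 1 with hJ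
  have h1 : ∀ d, a d < J d / N := fun d => by
    rw [lt_div_iff₀ hN0, hJ]; push_cast; exact Int.lt_floor_add_one _
  have h2 : ∀ d, ((J d : ℝ) + 1) / N < a d + ε := fun d => by
    rw [div_lt_iff₀ hN0, hJ]; push_cast
    have := Int.floor_le (a d * N)
    linarith
  have hmem : (fun d => ((J d : ℝ) + 1 / 2) / N) ∈ cube D := by
    refine ha fun d _ => ⟨(h1 d).trans ?_, lt_trans ?_ (h2 d)⟩ <;>
    · gcongr; linarith
  have hJ0 : ∀ d, 0 ≤ J d := fun d => by
    have := hmem.1 d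
    simp only [Pi.zero_apply] at this
    have h3 : (0 : ℝ) ≤ (J d : ℝ) + 1 / 2 := by
      by_contra hneg
      exact absurd this (not_le.2 (div_neg_of_neg_of_pos (not_le.1 hneg) hN0))
    have h4 : (-1 : ℝ) < J d := by linarith
    have h5 : (-1 : ℤ) < J d := by exact_mod_cast h4
    omega
  have hJN : ∀ d, J d < N := fun d => by
    have := hmem.2 d
    simp only [Pi.one_apply] at this
    rw [div_le_one hN0] at this
    have h4 : (J d : ℝ) < N := by linarith
    exact_mod_cast h4
  refine ⟨fun d => ⟨(J d).toNat, by have := hJ0 d; have := hJN d; omega⟩, fun z hz d _ => ?_⟩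
  have e : (((J d).toNat : ℕ) : ℝ) = J d := by
    exact_mod_cast Int.toNat_of_nonneg (hJ0 d)
  have hz1 := hz.1 d
  have hz2 := hz.2 d
  simp only [e] at hz1 hz2
  exact ⟨(h1 d).trans_le hz1, hz2.trans_lt (h2 d)⟩

/-- A slab of width at most the mesh is covered by two consecutive grid slabs. -/
lemma slab_inter_cube_subset {N : ℕ} (hN : 0 < N) {δ : ℝ} (hδ : δ * N ≤ 1) (d : Fin D) (c : ℝ) :
    slab d c δ ∩ cube D ⊆ ⋃ j ∈ {j : Fin (N + 1) | (j : ℤ) = ⌊c * N⌋ ∨ (j : ℤ) = ⌊c * N⌋ + 1},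
      slab d ((j : ℕ) / (N : ℝ)) (1 / N) := by
  have hN0 : (0 : ℝ) < N := by exact_mod_cast hN
  rintro z ⟨⟨hz1, hz2⟩, hz3, hz4⟩
  have h0 : 0 ≤ z d := hz3 d
  have h1 : z d ≤ 1 := hz4 d
  have hfl : ∀ j : ℤ, ⌊z d * N⌋ = j → (0 ≤ j ∧ j ≤ N) ∧ (j : ℝ) / N ≤ z d ∧
      z d ≤ (j : ℝ) / N + 1 / N := by
    rintro j rfl
    refine ⟨⟨Int.floor_nonneg.2 (by positivity), ?_⟩, ?_, ?_⟩
    · have : z d * N ≤ N := by nlinarith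
      have := (Int.floor_le (z d * N)).trans this
      exact_mod_cast this
    · rw [div_le_iff₀ hN0]; exact Int.floor_le _
    · rw [← add_div, le_div_iff₀ hN0]; exact (Int.lt_floor_add_one _).le
  obtain ⟨⟨hj0, hjN⟩, hl, hu⟩ := hfl _ rfl
  have e : (((⌊z d * N⌋).toNat : ℕ) : ℤ) = ⌊z d * N⌋ := Int.toNat_of_nonneg hj0
  have e' : (((⌊z d * N⌋).toNat : ℕ) : ℝ) = ⌊z d * N⌋ := by exact_mod_cast e
  simp only [Set.mem_iUnion]
  -- The index `N` occurs when `z d = 1`, whence `Fin (N + 1)`.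
  refine ⟨⟨(⌊z d * N⌋).toNat, by omega⟩, ?_, ?_⟩
  · have ha : ⌊c * N⌋ ≤ ⌊z d * N⌋ := Int.floor_le_floor (by gcongr)
    have hb : ⌊z d * N⌋ < ⌊c * N⌋ + 2 := by
      rw [Int.floor_lt]
      push_cast
      have := Int.lt_floor_add_one (c * N)
      nlinarith
    simp only [Set.mem_ofPred_eq, e]
    omega
  · show _ ∧ _
    simp only [e']
    exact ⟨hl, hu⟩

end Grid

/-! ### Row sums of the precision matrix and its convolution structure. -/

section Precision

variable {q n : ℕ} {L : Matrix (Fin q) (Fin q) ℝ} {ρ : Fin (q + 1) → ℝ}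

/-- A bound, uniform in `n`, for the absolute row and column sums of the Cholesky factor. -/
noncomputable def choleskyBound (q : ℕ) (L : Matrix (Fin q) (Fin q) ℝ) (ρ : Fin (q + 1) → ℝ) : ℝ :=
  (2 * q + 1) * (∑ i, ∑ j, |L i j| + ∑ a, |ρ a|)

lemma sum_abs_le_choleskyBound : ∑ a, |ρ a| ≤ choleskyBound q L ρ := by
  have h1 : 0 ≤ ∑ i, ∑ j, |L i j| :=
    Finset.sum_nonneg fun i _ => Finset.sum_nonneg fun j _ => abs_nonneg _
  have h2 : 0 ≤ ∑ a, |ρ a| := Finset.sum_nonneg fun i _ => abs_nonneg _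
  have h3 : (0 : ℝ) ≤ q := Nat.cast_nonneg q
  unfold choleskyBound
  nlinarith

lemma choleskyBound_nonneg : 0 ≤ choleskyBound q L ρ :=
  (Finset.sum_nonneg fun _ _ => abs_nonneg _).trans sum_abs_le_choleskyBound

lemma abs_choleskyFactor_le (i j : Fin n) :
    |choleskyFactor q L ρ n i j| ≤ ∑ i, ∑ j, |L i j| + ∑ a, |ρ a| := by
  have h1 : 0 ≤ ∑ i, ∑ j, |L i j| :=
    Finset.sum_nonneg fun i _ => Finset.sum_nonneg fun j _ => abs_nonneg _
  have h2 : 0 ≤ ∑ a, |ρ a| := Finset.sum_nonneg fun i _ => abs_nonneg _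
  simp only [choleskyFactor, Matrix.of_apply]
  split_ifs with hi hj h
  · have h3 : |L ⟨i, hi⟩ ⟨j, hj⟩| ≤ ∑ j', |L ⟨i, hi⟩ j'| :=
      Finset.single_le_sum (f := fun j' => |L ⟨i, hi⟩ j'|) (fun _ _ => abs_nonneg _)
        (Finset.mem_univ _)
    have h4 : ∑ j', |L ⟨i, hi⟩ j'| ≤ ∑ i', ∑ j', |L i' j'| :=
      Finset.single_le_sum (f := fun i' => ∑ j', |L i' j'|)
        (fun _ _ => Finset.sum_nonneg fun _ _ => abs_nonneg _) (Finset.mem_univ _)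
    linarith
  · rw [abs_zero]; positivity
  · have := Finset.single_le_sum (f := fun a => |ρ a|) (fun _ _ => abs_nonneg _)
      (Finset.mem_univ (⟨(i : ℕ) - j, Nat.lt_succ_of_le h.2⟩ : Fin (q + 1)))
    linarith
  · rw [abs_zero]; positivity

lemma choleskyFactor_band {i j : Fin n} (h : choleskyFactor q L ρ n i j ≠ 0) :
    (j : ℕ) ≤ i + q ∧ (i : ℕ) ≤ j + q := by
  simp only [choleskyFactor, Matrix.of_apply] at h
  split_ifs at h with hi hj h'
  · omega
  · exact absurd rfl h
  · omega
  · exact absurd rfl h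

lemma sum_abs_band_le {f : Fin n → ℝ} {a : ℝ} (i q : ℕ) (hf : ∀ j, |f j| ≤ a) (ha : 0 ≤ a)
    (hband : ∀ j, f j ≠ 0 → (j : ℕ) ≤ i + q ∧ i ≤ j + q) :
    ∑ j, |f j| ≤ (2 * q + 1) * a := by
  classical
  have hcard : (Finset.univ.filter fun j => f j ≠ 0).card ≤ 2 * q + 1 := by
    have h1 : ((Finset.univ.filter fun j => f j ≠ 0).image Fin.val) ⊆
        Finset.Icc (i - q) (i + q) := by
      intro m hm
      obtain ⟨j, hj, rfl⟩ := Finset.mem_image.1 hm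
      have := hband j (Finset.mem_filter.1 hj).2
      rw [Finset.mem_Icc]; omega
    have h2 := Finset.card_le_card h1
    rw [Finset.card_image_of_injective _ Fin.val_injective, Nat.card_Icc] at h2
    omega
  calc ∑ j, |f j| = ∑ j ∈ Finset.univ.filter fun j => f j ≠ 0, |f j| := by
        rw [Finset.sum_filter]
        refine Finset.sum_congr rfl fun j _ => ?_
        split_ifs with h
        · rfl
        · push Not at h; simp [h]
    _ ≤ ∑ _j ∈ Finset.univ.filter fun j => f j ≠ 0, a := Finset.sum_le_sum fun j _ => hf j
    _ = (Finset.univ.filter fun j => f j ≠ 0).card * a := by rw [Finset.sum_const, nsmul_eq_mul]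
    _ ≤ (2 * q + 1) * a := mul_le_mul_of_nonneg_right (by exact_mod_cast hcard) ha

lemma entry_bound_nonneg : 0 ≤ ∑ i, ∑ j, |L i j| + ∑ a, |ρ a| :=
  add_nonneg (Finset.sum_nonneg fun _ _ => Finset.sum_nonneg fun _ _ => abs_nonneg _)
    (Finset.sum_nonneg fun _ _ => abs_nonneg _)

lemma choleskyFactor_row_sum_le (i : Fin n) :
    ∑ j, |choleskyFactor q L ρ n i j| ≤ choleskyBound q L ρ :=
  sum_abs_band_le i q (fun j => abs_choleskyFactor_le i j) entry_bound_nonneg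
    fun _ h => choleskyFactor_band h

lemma choleskyFactor_col_sum_le (j : Fin n) :
    ∑ i, |choleskyFactor q L ρ n i j| ≤ choleskyBound q L ρ :=
  sum_abs_band_le j q (fun i => abs_choleskyFactor_le i j) entry_bound_nonneg
    fun _ h => (choleskyFactor_band h).symm

lemma precision_isSymm : (precision q L ρ n).IsSymm := by
  unfold precision
  exact Matrix.isSymm_transpose_mul_self _

/-- A row sum of `Aᵀ * A` is at most the product of a column bound and a row bound of `A`. With
Schur's test this bounds the quadratic form uniformly in `n`. -/
lemma precision_row_sum_le (i : Fin n) :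
    ∑ j, |precision q L ρ n i j| ≤ choleskyBound q L ρ ^ 2 := by
  set A := choleskyFactor q L ρ n with hA
  calc ∑ j, |precision q L ρ n i j| = ∑ j, |∑ l, A l i * A l j| := rfl
    _ ≤ ∑ j, ∑ l, |A l i| * |A l j| := Finset.sum_le_sum fun j _ =>
        (Finset.abs_sum_le_sum_abs _ _).trans (Finset.sum_le_sum fun l _ => (abs_mul _ _).le)
    _ = ∑ l, |A l i| * ∑ j, |A l j| := by
        rw [Finset.sum_comm]; simp_rw [Finset.mul_sum]
    _ ≤ ∑ l, |A l i| * choleskyBound q L ρ := Finset.sum_le_sum fun l _ =>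
        mul_le_mul_of_nonneg_left (choleskyFactor_row_sum_le l) (abs_nonneg _)
    _ = (∑ l, |A l i|) * choleskyBound q L ρ := by rw [Finset.sum_mul]
    _ ≤ choleskyBound q L ρ * choleskyBound q L ρ :=
        mul_le_mul_of_nonneg_right (choleskyFactor_col_sum_le i) choleskyBound_nonneg
    _ = _ := by ring

/-- Below its first `q` rows the Cholesky factor acts as a convolution. -/
lemma choleskyFactor_mulVec_of_le (w : ℕ → ℝ) (l : Fin n) (hl : q ≤ (l : ℕ)) :
    (choleskyFactor q L ρ n *ᵥ fun i => w i) l = ∑ b : Fin (q + 1), ρ b * w (l - b) := by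
  have h1 : ∀ b : Fin (q + 1), ρ b * w (l - b)
      = ∑ j : Fin n, if (j : ℕ) = l - b then ρ b * w j else 0 := by
    intro b
    have hlt : (l : ℕ) - b < n := by omega
    rw [Finset.sum_eq_single (⟨(l : ℕ) - b, hlt⟩ : Fin n)]
    · simp
    · intro j _ hj
      rw [if_neg fun h => hj (Fin.ext h)]
    · simp
  simp_rw [h1]
  rw [Finset.sum_comm]
  show ∑ j : Fin n, choleskyFactor q L ρ n l j * w j = _
  refine Finset.sum_congr rfl fun j _ => ?_
  simp only [choleskyFactor, Matrix.of_apply]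
  rw [dif_neg (not_lt.2 hl)]
  split_ifs with h
  · rw [Finset.sum_eq_single (⟨(l : ℕ) - j, Nat.lt_succ_of_le h.2⟩ : Fin (q + 1))]
    · rw [if_pos]
      show (j : ℕ) = l - (l - j)
      omega
    · intro b _ hb
      rw [if_neg fun hj => hb (Fin.ext ?_)]
      show (b : ℕ) = l - j
      have := b.2
      omega
    · simp
  · refine (zero_mul _).trans (Finset.sum_eq_zero fun b _ => ?_).symm
    rw [if_neg]
    have := b.2
    omega

/-- The positions `l - b` with `q ≤ l < n` and `l - a ∈ I`. -/
def shifted (q n : ℕ) (I : Finset ℕ) (a b : Fin (q + 1)) : Finset ℕ :=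
  ((Finset.range n).filter fun l => q ≤ l ∧ l - a ∈ I).image fun l => l - b

/-- Since `l` is at least `q` and `c` is at most `q`, the truncated subtraction never truncates. -/
lemma shifted_injOn (q n : ℕ) (I : Finset ℕ) (a c : Fin (q + 1)) :
    Set.InjOn (fun l => l - (c : ℕ))
      ((Finset.range n).filter fun l => q ≤ l ∧ l - a ∈ I : Finset ℕ) := by
  intro l hl l' hl' h
  have h1 := (Finset.mem_filter.1 hl).2.1
  have h2 := (Finset.mem_filter.1 hl').2.1
  have := c.2
  simp only at h
  omega

lemma sum_shifted (I : Finset ℕ) (a b : Fin (q + 1)) (w : ℕ → ℝ) :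
    ∑ j ∈ shifted q n I a b, w j =
      ∑ l ∈ (Finset.range n).filter fun l => q ≤ l ∧ l - a ∈ I, w (l - b) :=
  Finset.sum_image (shifted_injOn q n I a b)

lemma card_shifted_le (I : Finset ℕ) (a b : Fin (q + 1)) :
    (shifted q n I a b).card ≤ I.card := by
  refine Finset.card_image_le.trans ?_
  refine Finset.card_le_card_of_injOn (fun l => l - (a : ℕ)) ?_ (shifted_injOn q n I a a)
  intro l hl
  exact (Finset.mem_filter.1 hl).2.2

lemma shifted_subset (I : Finset ℕ) (a b : Fin (q + 1)) :
    shifted q n I a b ⊆ Finset.range n := by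
  intro j hj
  obtain ⟨l, hl, rfl⟩ := Finset.mem_image.1 hj
  have := Finset.mem_range.1 (Finset.mem_filter.1 hl).1
  rw [Finset.mem_range]
  omega

/-- A sum over an index set, weighted by the precision matrix, reduces to sums over shifted index
sets and a boundary term. -/
lemma abs_indicator_precision_le (I : Finset ℕ) {w : ℕ → ℝ} {E c : ℝ} (hE : ∀ i < n, |w i| ≤ E)
    (hE0 : 0 ≤ E) (hc0 : 0 ≤ c)
    (hc : ∀ a b : Fin (q + 1), |∑ j ∈ shifted q n I a b, w j| ≤ c) :
    |(fun i : Fin n => if (i : ℕ) ∈ I then (1 : ℝ) else 0) ⬝ᵥ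
        (precision q L ρ n *ᵥ fun i : Fin n => w i)| ≤
      choleskyBound q L ρ ^ 2 * (c + q * E) := by
  set A := choleskyFactor q L ρ n with hA
  set R := choleskyBound q L ρ with hR
  have hR0 : 0 ≤ R := choleskyBound_nonneg
  set eN : ℕ → ℝ := fun i => if i ∈ I then (1 : ℝ) else 0 with heN
  -- With the precision matrix as `Aᵀ * A` the form pairs `A e` with `A w`. Rows from `q` on are
  -- convolutions and give the shifted sums; the first `q` rows are bounded crudely.
  have hexp : (fun i : Fin n => eN i) ⬝ᵥ (precision q L ρ n *ᵥ fun i : Fin n => w i)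
      = ∑ l : Fin n, (A *ᵥ fun i : Fin n => eN i) l * (A *ᵥ fun i : Fin n => w i) l := by
    unfold precision
    rw [← Matrix.mulVec_mulVec, Matrix.dotProduct_mulVec, Matrix.vecMul_transpose]
    rfl
  have hmul : ∀ (u : ℕ → ℝ) (b : ℝ), 0 ≤ b → (∀ i < n, |u i| ≤ b) →
      ∀ l, |(A *ᵥ fun i : Fin n => u i) l| ≤ R * b := fun u b hb hu l =>
    abs_mulVec_apply_le (fun i => choleskyFactor_row_sum_le i) hb (fun i => hu i i.2) l
  have he1 : ∀ i < n, |eN i| ≤ 1 := fun i _ => by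
    simp only [heN]; split_ifs <;> simp
  show |(fun i : Fin n => eN i) ⬝ᵥ _| ≤ _
  rw [hexp, ← Finset.sum_filter_add_sum_filter_not Finset.univ (fun l : Fin n => q ≤ (l : ℕ))]
  have hbulk : |∑ l ∈ Finset.univ.filter fun l : Fin n => q ≤ (l : ℕ),
      (A *ᵥ fun i : Fin n => eN i) l * (A *ᵥ fun i : Fin n => w i) l| ≤ R ^ 2 * c := by
    have h1 : ∑ l ∈ Finset.univ.filter fun l : Fin n => q ≤ (l : ℕ),
        (A *ᵥ fun i : Fin n => eN i) l * (A *ᵥ fun i : Fin n => w i) l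
        = ∑ a, ∑ b, ρ a * ρ b * ∑ j ∈ shifted q n I a b, w j := by
      have h2 : ∀ a b : Fin (q + 1), ∑ j ∈ shifted q n I a b, w j =
          ∑ l ∈ Finset.univ.filter fun l : Fin n => q ≤ (l : ℕ), eN (l - a) * w (l - b) := by
        intro a b
        rw [sum_shifted, Finset.sum_filter, Finset.sum_filter, Finset.sum_range]
        refine Finset.sum_congr rfl fun l _ => ?_
        by_cases hl : q ≤ (l : ℕ) <;> by_cases hl' : (l : ℕ) - a ∈ I <;> simp [heN, hl, hl']
      simp_rw [h2, Finset.mul_sum]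
      have h3 : ∀ l ∈ Finset.univ.filter fun l : Fin n => q ≤ (l : ℕ),
          (A *ᵥ fun i : Fin n => eN i) l * (A *ᵥ fun i : Fin n => w i) l
          = ∑ a : Fin (q + 1), ∑ b : Fin (q + 1), ρ a * ρ b * (eN (l - a) * w (l - b)) := by
        intro l hl
        have hl' := (Finset.mem_filter.1 hl).2
        rw [hA, choleskyFactor_mulVec_of_le _ l hl', choleskyFactor_mulVec_of_le _ l hl',
          Finset.sum_mul_sum]
        refine Finset.sum_congr rfl fun a _ => Finset.sum_congr rfl fun b _ => ?_
        ring
      rw [Finset.sum_congr rfl h3, Finset.sum_comm]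
      refine Finset.sum_congr rfl fun a _ => ?_
      rw [Finset.sum_comm]
    rw [h1]
    calc |∑ a, ∑ b, ρ a * ρ b * ∑ j ∈ shifted q n I a b, w j|
        ≤ ∑ a, ∑ b, |ρ a * ρ b * ∑ j ∈ shifted q n I a b, w j| :=
          (Finset.abs_sum_le_sum_abs _ _).trans
            (Finset.sum_le_sum fun a _ => Finset.abs_sum_le_sum_abs _ _)
      _ ≤ ∑ a, ∑ b, |ρ a| * |ρ b| * c := by
          refine Finset.sum_le_sum fun a _ => Finset.sum_le_sum fun b _ => ?_
          rw [abs_mul, abs_mul]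
          exact mul_le_mul_of_nonneg_left (hc a b) (by positivity)
      _ = (∑ a, |ρ a|) ^ 2 * c := by
          rw [sq, Finset.sum_mul_sum, Finset.sum_mul]
          simp_rw [Finset.sum_mul]
      _ ≤ R ^ 2 * c := by
          refine mul_le_mul_of_nonneg_right ?_ hc0
          exact pow_le_pow_left₀ (Finset.sum_nonneg fun _ _ => abs_nonneg _)
            sum_abs_le_choleskyBound 2
  have hbdry : |∑ l ∈ Finset.univ.filter fun l : Fin n => ¬ q ≤ (l : ℕ),
      (A *ᵥ fun i : Fin n => eN i) l * (A *ᵥ fun i : Fin n => w i) l| ≤ R ^ 2 * (q * E) := by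
    have hcard : (Finset.univ.filter fun l : Fin n => ¬ q ≤ (l : ℕ)).card ≤ q := by
      rw [← Finset.card_image_of_injective _ Fin.val_injective]
      refine (Finset.card_le_card (t := Finset.range q) ?_).trans (Finset.card_range q).le
      intro m hm
      obtain ⟨j, hj, rfl⟩ := Finset.mem_image.1 hm
      simpa using hj
    calc |∑ l ∈ Finset.univ.filter fun l : Fin n => ¬ q ≤ (l : ℕ),
          (A *ᵥ fun i : Fin n => eN i) l * (A *ᵥ fun i : Fin n => w i) l|
        ≤ ∑ l ∈ Finset.univ.filter fun l : Fin n => ¬ q ≤ (l : ℕ), (R * 1) * (R * E) := by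
          refine (Finset.abs_sum_le_sum_abs _ _).trans (Finset.sum_le_sum fun l _ => ?_)
          rw [abs_mul]
          exact mul_le_mul (hmul eN 1 zero_le_one he1 l) (hmul w E hE0 hE l) (abs_nonneg _)
            (by positivity)
      _ = (Finset.univ.filter fun l : Fin n => ¬ q ≤ (l : ℕ)).card * (R ^ 2 * E) := by
          rw [Finset.sum_const, nsmul_eq_mul]; ring
      _ ≤ q * (R ^ 2 * E) := mul_le_mul_of_nonneg_right (by exact_mod_cast hcard) (by positivity)
      _ = _ := by ring
  refine (abs_add_le _ _).trans ?_
  linarith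

end Precision

/-! ### Comparison of the losses of two labellings. -/

section Comparison

variable {n : ℕ} {Q : Matrix (Fin n) (Fin n) ℝ}

/-- The minimiser for `lab` competes for `lab'`. Its coefficients are evaluated at the labels of
`lab'` too, so these must also have large classes under `lab`. -/
lemma loss_le_loss_add {κ : Type*} [DecidableEq κ] (hQ : Q.IsSymm) {ξ K B η θ τ L L' : ℝ}
    (hξ : 0 < ξ) (hη : 0 < η) (hτ : 0 < τ) (hn : 0 < n)
    (hlow : ∀ v, ξ * ∑ i, v i ^ 2 ≤ quad Q v) (hup : ∀ v, quad Q v ≤ K * ∑ i, v i ^ 2)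
    (hK : 0 ≤ K) (hB : 0 ≤ B) {lab lab' : Fin n → κ} {Y : Fin n → ℝ}
    (hY : ∑ i, Y i ^ 2 ≤ B * n)
    (hL : IsLeast (Set.range fun β : κ → ℝ => quad Q (Y - β ∘ lab)) L)
    (hL' : IsLeast (Set.range fun β : κ → ℝ => quad Q (Y - β ∘ lab')) L')
    (hl : ∀ i, η * n ≤ (Finset.univ.filter fun j => lab j = lab i).card)
    (hl' : ∀ i, η * n ≤ (Finset.univ.filter fun j => lab j = lab' i).card)
    (hθ : ((Finset.univ.filter fun i => lab i ≠ lab' i).card : ℝ) ≤ θ * n) :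
    L' ≤ L + n * (τ * (K * B) + (1 + 1 / τ) * (K * (4 * (4 * K * B / (ξ * η)) * θ))) := by
  have h0 : ∀ v, 0 ≤ quad Q v := fun v =>
    (mul_nonneg hξ.le (Finset.sum_nonneg fun i _ => sq_nonneg _)).trans (hlow v)
  obtain ⟨γ, hγ⟩ := hL.1
  have hLY : L ≤ quad Q Y := by
    have := hL.2 ⟨0, rfl⟩
    have e : Y - (0 : κ → ℝ) ∘ lab = Y := by funext i; simp
    simpa [e] using this
  have hYK : quad Q Y ≤ K * (B * n) := (hup Y).trans (mul_le_mul_of_nonneg_left hY hK)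
  have hγ' : quad Q (Y - γ ∘ lab) ≤ quad Q Y := hγ.trans_le hLY
  have h1 := loss_le_of_agree (lab' := lab') hQ h0 hτ hup hK hγ (fun β => hL'.2 ⟨β, rfl⟩)
    (fun i => coeff_sq_le hQ hξ hη hn hlow hup hK hY hγ' (hl i))
    (fun i => coeff_sq_le hQ hξ hη hn hlow hup hK hY hγ' (hl' i))
  have h2 : τ * L ≤ τ * (K * (B * n)) := mul_le_mul_of_nonneg_left (hLY.trans hYK) hτ.le
  have h3 : 0 ≤ 4 * (4 * K * B / (ξ * η)) := by positivity
  have h4 : (1 + 1 / τ) * (K * (4 * (4 * K * B / (ξ * η)) *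
      (Finset.univ.filter fun i => lab i ≠ lab' i).card))
      ≤ (1 + 1 / τ) * (K * (4 * (4 * K * B / (ξ * η)) * (θ * n))) := by gcongr
  linarith

/-- Two labellings with large classes which differ at few observations have close losses. -/
lemma abs_loss_sub_le {κ : Type*} [DecidableEq κ] (hQ : Q.IsSymm) {ξ K B η θ τ L L' : ℝ}
    (hξ : 0 < ξ) (hη : 0 < η) (hτ : 0 < τ) (hn : 0 < n)
    (hlow : ∀ v, ξ * ∑ i, v i ^ 2 ≤ quad Q v) (hup : ∀ v, quad Q v ≤ K * ∑ i, v i ^ 2)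
    (hK : 0 ≤ K) (hB : 0 ≤ B) {lab lab' : Fin n → κ} {Y : Fin n → ℝ}
    (hY : ∑ i, Y i ^ 2 ≤ B * n)
    (hL : IsLeast (Set.range fun β : κ → ℝ => quad Q (Y - β ∘ lab)) L)
    (hL' : IsLeast (Set.range fun β : κ → ℝ => quad Q (Y - β ∘ lab')) L')
    {V : Set κ} (hV : ∀ l ∈ V, η * n ≤ (Finset.univ.filter fun j => lab j = l).card)
    (hV' : ∀ l ∈ V, η * n ≤ (Finset.univ.filter fun j => lab' j = l).card)
    (hlab : ∀ i, lab i ∈ V) (hlab' : ∀ i, lab' i ∈ V)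
    (hθ : ((Finset.univ.filter fun i => lab i ≠ lab' i).card : ℝ) ≤ θ * n) :
    |L - L'| ≤ n * (τ * (K * B) + (1 + 1 / τ) * (K * (4 * (4 * K * B / (ξ * η)) * θ))) := by
  have h1 := loss_le_loss_add hQ hξ hη hτ hn hlow hup hK hB hY hL hL' (fun i => hV _ (hlab i))
    (fun i => hV _ (hlab' i)) hθ
  have h2 := loss_le_loss_add hQ hξ hη hτ hn hlow hup hK hB hY hL' hL (fun i => hV' _ (hlab' i))
    (fun i => hV' _ (hlab i)) (by simpa only [ne_comm] using hθ)
  rw [abs_le]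
  constructor <;> linarith

end Comparison

/-! ### Deterministic conditions on a sample and their counting consequences. -/

section GoodSample

variable {D k q n : ℕ}

open Classical in
/-- The indices of the observations that satisfy finitely many half-space constraints. -/
noncomputable def boxIndex {κ : Type*} (n : ℕ) (X : ℕ → Fin D → ℝ) (T : κ → Split D × Bool) :
    Finset ℕ :=
  (Finset.range n).filter fun i => ∀ o, X i ∈ side (T o).1 (T o).2

lemma boxIndex_subset {κ : Type*} (X : ℕ → Fin D → ℝ) (T : κ → Split D × Bool) :
    boxIndex n X T ⊆ Finset.range n := by
  classical
  exact Finset.filter_subset _ _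

open Classical in
/-- The number of observations in a region. -/
noncomputable def countIn (n : ℕ) (X : ℕ → Fin D → ℝ) (S : Set (Fin D → ℝ)) : ℕ :=
  ((Finset.range n).filter fun i => X i ∈ S).card

lemma countIn_mono {X : ℕ → Fin D → ℝ} {S S' : Set (Fin D → ℝ)}
    (h : ∀ i < n, X i ∈ S → X i ∈ S') : countIn n X S ≤ countIn n X S' := by
  classical
  refine Finset.card_le_card fun i hi => ?_
  simp only [Finset.mem_filter, Finset.mem_range] at hi ⊢
  exact ⟨hi.1, h i hi.1 hi.2⟩

open Classical in
lemma countIn_eq_card (X : ℕ → Fin D → ℝ) (S : Set (Fin D → ℝ)) :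
    countIn n X S = (Finset.univ.filter fun i : Fin n => X i ∈ S).card := by
  unfold countIn
  rw [← Finset.card_image_of_injective _ Fin.val_injective]
  congr 1
  ext i
  simp only [Finset.mem_filter, Finset.mem_range, Finset.mem_image, Finset.mem_univ, true_and]
  constructor
  · exact fun h => ⟨⟨i, h.1⟩, h.2, rfl⟩
  · rintro ⟨j, hj, rfl⟩
    exact ⟨j.2, hj⟩

/-- The properties of a sample of size `n` on which the oscillation bound rests. -/
structure GoodSample (D k q n : ℕ) (X : ℕ → Fin D → ℝ) (w : ℕ → ℝ) (ε σ E κ δ θ : ℝ) : Prop where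
  mem_cube : ∀ i < n, X i ∈ cube D
  sum_sq_le : ∑ i ∈ Finset.range n, w i ^ 2 ≤ σ * n
  abs_le : ∀ i < n, |w i| ≤ E
  le_count_cube : ∀ a : Fin D → ℝ, (Set.univ.pi fun d => Set.Ioo (a d) (a d + ε)) ⊆ cube D →
    κ * n ≤ countIn n X (Set.univ.pi fun d => Set.Ioo (a d) (a d + ε))
  count_slab_le : ∀ d c, (countIn n X (slab d c δ) : ℝ) ≤ θ * n
  -- The term `√n * E` covers shifted sets with fewer than `√n` elements, for which only the maximal
  -- error is available.
  abs_sum_le : ∀ T : Option (Fin (k - 1)) → Split D × Bool, ∀ a b : Fin (q + 1),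
    |∑ j ∈ shifted q n (boxIndex n X T) a b, w j| ≤ (boxIndex n X T).card + √n * E

variable {X : ℕ → Fin D → ℝ} {w : ℕ → ℝ} {ε σ E κ δ θ : ℝ}

/-- The half-space constraints that define a child of the node `p`. -/
def childBox (s : SplitVector D k) (p : LevelNode k) (b : Bool) :
    Option (Fin (k - 1)) → Split D × Bool
  | some j => (s.prev ⟨j, fun i => p (Fin.castLE j.isLt.le i)⟩, p j)
  | none => (s.last, b)

lemma GoodSample.mem_boxIndex_childBox (h : GoodSample D k q n X w ε σ E κ δ θ)
    (s : SplitVector D k) (x : Fin D → ℝ) (b : Bool) (i : Fin n) :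
    (i : ℕ) ∈ boxIndex n X (childBox s (cellLabel s x) b) ↔
      childLabel (fun i : Fin n => X i) x s i = (cellLabel s x, b) := by
  have hX := h.mem_cube i i.2
  simp only [boxIndex, Finset.mem_filter, Finset.mem_range, i.2, true_and, Option.forall,
    childLabel, refineLabel, Prod.mk.injEq]
  have h1 : (∀ j, X i ∈ side (childBox s (cellLabel s x) b (some j)).1
      (childBox s (cellLabel s x) b (some j)).2) ↔ cellLabel s (X i) = cellLabel s x := by
    rw [← mem_cell_iff s hX]
    exact ⟨fun h => ⟨hX, h⟩, fun h => h.2⟩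
  have h2 : X i ∈ side (childBox s (cellLabel s x) b none).1
      (childBox s (cellLabel s x) b none).2 ↔ lastBit s (X i) = b := mem_side_last_iff s _ b
  rw [h1, h2, and_comm]
  refine and_congr_right fun h => ?_
  simp [h]

lemma GoodSample.card_cellLabel (h : GoodSample D k q n X w ε σ E κ δ θ) {s : SplitVector D k}
    (hs : s ∈ wideSplits D k ε) (p : LevelNode k) :
    κ * n ≤ (Finset.univ.filter fun i : Fin n => cellLabel s (X i) = p).card := by
  classical
  obtain ⟨a, ha⟩ := hs p
  refine (h.le_count_cube a (ha.trans fun z hz => hz.1)).trans ?_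
  rw [countIn_eq_card]
  refine Nat.cast_le.2 (Finset.card_le_card fun i hi => ?_)
  simp only [Finset.mem_filter, Finset.mem_univ, true_and] at hi ⊢
  exact (mem_cell_iff s (h.mem_cube i i.2) p).1 (ha hi)

lemma GoodSample.card_childLabel_of_ne (h : GoodSample D k q n X w ε σ E κ δ θ)
    {s : SplitVector D k} (hs : s ∈ wideSplits D k ε) (x : Fin D → ℝ) {p : LevelNode k}
    (hp : p ≠ cellLabel s x) :
    κ * n ≤ (Finset.univ.filter fun i : Fin n =>
      childLabel (fun i : Fin n => X i) x s i = (p, false)).card := by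
  refine (h.card_cellLabel hs p).trans (Nat.cast_le.2 (Finset.card_le_card fun i hi => ?_))
  simp only [Finset.mem_filter, Finset.mem_univ, true_and] at hi ⊢
  simp [childLabel, refineLabel, hi, hp]

/-- A changed label puts the observation in the slab of some split, the last one included.
`SameNode` matters: otherwise the refinement would take place in different nodes and most labels
there could change. -/
lemma GoodSample.card_childLabel_ne_le (h : GoodSample D k q n X w ε σ E κ δ θ) (hδ : δ < 1)
    {s t : SplitVector D k} (hd : splitDist s t ≤ δ) {x : Fin D → ℝ} (hx : x ∈ cube D)
    (hst : SameNode x s t) :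
    ((Finset.univ.filter fun i : Fin n => childLabel (fun i : Fin n => X i) x s i
      ≠ childLabel (fun i : Fin n => X i) x t i).card : ℝ)
      ≤ Fintype.card (Option (InnerNode k)) * θ * n := by
  classical
  set S : Option (InnerNode k) → Set (Fin D → ℝ) := fun o => o.elim
    (slab s.last.1 (min s.last.2 t.last.2) δ)
    fun a => slab (s.prev a).1 (min (s.prev a).2 (t.prev a).2) δ with hS
  have hsub : (Finset.univ.filter fun i : Fin n => childLabel (fun i : Fin n => X i) x s i
      ≠ childLabel (fun i : Fin n => X i) x t i) ⊆
      Finset.univ.biUnion fun o => Finset.univ.filter fun i : Fin n => X i ∈ S o := by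
    intro i hi
    simp only [Finset.mem_filter, Finset.mem_univ, true_and, Finset.mem_biUnion] at hi ⊢
    by_cases hc : cellLabel s (X i) = cellLabel t (X i)
    · refine ⟨none, mem_slab_of_lastBit_ne hδ hd fun hb => hi ?_⟩
      simp only [childLabel, refineLabel, hc, hb, cellLabel_eq_of_sameNode hx hst]
    · obtain ⟨a, ha⟩ := exists_mem_slab_of_cellLabel_ne hδ hd hc
      exact ⟨some a, ha⟩
  have hcount : ∀ o, ((Finset.univ.filter fun i : Fin n => X i ∈ S o).card : ℝ) ≤ θ * n := by
    rintro (_ | a)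
    · rw [← countIn_eq_card]; exact h.count_slab_le _ _
    · rw [← countIn_eq_card]; exact h.count_slab_le _ _
  calc _ ≤ ((Finset.univ.biUnion fun o =>
        Finset.univ.filter fun i : Fin n => X i ∈ S o).card : ℝ) :=
        Nat.cast_le.2 (Finset.card_le_card hsub)
    _ ≤ ∑ o, ((Finset.univ.filter fun i : Fin n => X i ∈ S o).card : ℝ) := by
        exact_mod_cast Finset.card_biUnion_le
    _ ≤ ∑ _o : Option (InnerNode k), θ * n := Finset.sum_le_sum fun o _ => hcount o
    _ = _ := by rw [Finset.sum_const, nsmul_eq_mul, Finset.card_univ, mul_assoc]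

lemma GoodSample.sum_response_sq_le (h : GoodSample D k q n X w ε σ E κ δ θ)
    {m : (Fin D → ℝ) → ℝ} {M : ℝ} (hm : ∀ z ∈ cube D, |m z| ≤ M) :
    ∑ i : Fin n, (m (X i) + w i) ^ 2 ≤ (2 * M ^ 2 + 2 * σ) * n := by
  have h1 : ∀ i : Fin n, (m (X i) + w i) ^ 2 ≤ 2 * M ^ 2 + 2 * w i ^ 2 := by
    intro i
    have h2 := hm _ (h.mem_cube i i.2)
    have h3 : m (X i) ^ 2 ≤ M ^ 2 := sq_le_sq' (by linarith [(_root_.abs_le.1 h2).1])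
      (_root_.abs_le.1 h2).2
    nlinarith [sq_nonneg (m (X i) - w i)]
  have h2 := h.sum_sq_le
  rw [Finset.sum_range] at h2
  calc ∑ i : Fin n, (m (X i) + w i) ^ 2 ≤ ∑ i : Fin n, (2 * M ^ 2 + 2 * w i ^ 2) :=
        Finset.sum_le_sum fun i _ => h1 i
    _ = 2 * M ^ 2 * n + 2 * ∑ i : Fin n, w i ^ 2 := by
        rw [Finset.sum_add_distrib, Finset.sum_const, ← Finset.mul_sum, nsmul_eq_mul,
          Finset.card_univ, Fintype.card_fin]; ring
    _ ≤ _ := by linarith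

end GoodSample

/-! ### The gain from a split with a small child. -/

section Gain

variable {D k q n : ℕ} {L : Matrix (Fin q) (Fin q) ℝ} {ρ : Fin (q + 1) → ℝ}
  {X : ℕ → Fin D → ℝ} {w : ℕ → ℝ} {ε σ E κ δ θ : ℝ}

/-- Elementary estimate: a sum over `c` observations that is at most `K c (E + a)` and at most
`K (c (1 + a) + √n E)` has a small normalized square. -/
lemma sq_div_card_le {K a x ξ N c : ℝ} (hξ : 0 < ξ) (hK : 0 ≤ K) (hE : 0 ≤ E) (ha : 0 ≤ a)
    (hN : 0 < N) (hc : 0 ≤ c) (h1 : |x| ≤ K * (c * (E + a)))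
    (h2 : |x| ≤ K * (c * (1 + a) + √N * E)) :
    2 * x ^ 2 / (ξ * c) ≤ 2 * K ^ 2 / ξ * ((2 + a) ^ 2 * c + (E + a) ^ 2 * (√N * E)) := by
  have hs : 0 ≤ √N * E := by positivity
  rcases hc.eq_or_lt with rfl | hc'
  · simp only [mul_zero, div_zero]
    positivity
  have hx : x ^ 2 ≤ K ^ 2 * c * ((2 + a) ^ 2 * c + (E + a) ^ 2 * (√N * E)) := by
    rw [← sq_abs]
    -- Above this threshold the concentration bound is linear in `c`; below it the bound by the
    -- maximal error is used, with one factor `c` replaced by `√N * E`.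
    rcases le_total (√N * E) c with h | h
    · have h3 : |x| ≤ K * (c * (2 + a)) := h2.trans (mul_le_mul_of_nonneg_left (by linarith) hK)
      have h4 := pow_le_pow_left₀ (abs_nonneg x) h3 2
      have h5 : 0 ≤ K ^ 2 * c * ((E + a) ^ 2 * (√N * E)) := by positivity
      nlinarith
    · have h4 := pow_le_pow_left₀ (abs_nonneg x) h1 2
      have h5 : 0 ≤ K ^ 2 * c * ((2 + a) ^ 2 * c) := by positivity
      have h6 : K ^ 2 * c * ((E + a) ^ 2 * c) ≤ K ^ 2 * c * ((E + a) ^ 2 * (√N * E)) := by gcongr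
      nlinarith
  rw [div_le_iff₀ (by positivity)]
  have e : 2 * K ^ 2 / ξ * ((2 + a) ^ 2 * c + (E + a) ^ 2 * (√N * E)) * (ξ * c)
      = 2 * (K ^ 2 * c * ((2 + a) ^ 2 * c + (E + a) ^ 2 * (√N * E))) := by
    field_simp
  rw [e]
  linarith

/-- Splitting off a small child reduces the loss only slightly. -/
lemma GoodSample.gain_le (h : GoodSample D k q n X w ε σ E κ δ θ) {ξ : ℝ} (hξ : 0 < ξ)
    (hn : 0 < n) (hE : 0 ≤ E) (hκ : 0 < κ)
    (hlow : ∀ v, ξ * ∑ i, v i ^ 2 ≤ quad (precision q L ρ n) v)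
    {m : (Fin D → ℝ) → ℝ} {M : ℝ} (hm : ∀ z ∈ cube D, |m z| ≤ M) (hM : 0 ≤ M)
    {x : Fin D → ℝ} {s : SplitVector D k}
    (hs : s ∈ wideSplits D k ε) {L₀ L₁ η : ℝ}
    (hL₀ : IsLeast (Set.range fun β : LevelNode k → ℝ => quad (precision q L ρ n)
      ((fun i : Fin n => m (X i) + w i) - β ∘ fun i : Fin n => cellLabel s (X i))) L₀)
    (hL₁ : IsLeast (Set.range fun β : LevelNode k × Bool → ℝ => quad (precision q L ρ n)
      ((fun i : Fin n => m (X i) + w i) - β ∘ childLabel (fun i : Fin n => X i) x s)) L₁)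
    {b : Bool} (hb : ((Finset.univ.filter fun i : Fin n =>
      childLabel (fun i : Fin n => X i) x s i = (cellLabel s x, b)).card : ℝ) ≤ η * n) :
    L₀ - L₁ ≤ n * (2 * (choleskyBound q L ρ ^ 2 * (q + 1)) ^ 2 / ξ *
      ((2 + (M + √(4 * choleskyBound q L ρ ^ 2 * (2 * M ^ 2 + 2 * σ) / (ξ * κ)))) ^ 2 * η +
        (E + (M + √(4 * choleskyBound q L ρ ^ 2 * (2 * M ^ 2 + 2 * σ) / (ξ * κ)))) ^ 2
          * (E / √n))) := by
  classical
  set R := choleskyBound q L ρ with hR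
  set B := 2 * M ^ 2 + 2 * σ with hB
  set a := M + √(4 * R ^ 2 * B / (ξ * κ)) with ha
  set Y : Fin n → ℝ := fun i => m (X i) + w i with hY
  set cnt : Bool → Finset (Fin n) := fun b => Finset.univ.filter fun i : Fin n =>
      childLabel (fun i : Fin n => X i) x s i = (cellLabel s x, b) with hcnt
  have hnR : (0 : ℝ) < n := by exact_mod_cast hn
  have ha0 : 0 ≤ a := by positivity
  have hn1 : (1 : ℝ) ≤ √n := by rw [Real.one_le_sqrt]; exact_mod_cast hn
  have hsymm : (precision q L ρ n).IsSymm := precision_isSymm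
  have hrow := precision_row_sum_le (q := q) (L := L) (ρ := ρ) (n := n)
  have hup := quad_le hsymm hrow
  -- choose the smaller child
  obtain ⟨b', hle, hsmall⟩ : ∃ b', (cnt b').card ≤ (cnt !b').card ∧
      ((cnt b').card : ℝ) ≤ η * n := by
    rcases le_total (cnt b).card (cnt !b).card with hc | hc
    · exact ⟨b, hc, hb⟩
    · exact ⟨!b, by simpa using hc, (Nat.cast_le.2 hc).trans hb⟩
  obtain ⟨γ, hγ⟩ := hL₀.1
  simp only at hγ
  have hγmin : ∀ β : LevelNode k → ℝ, quad (precision q L ρ n)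
      (Y - γ ∘ fun i : Fin n => cellLabel s (X i)) ≤ quad (precision q L ρ n)
      (Y - β ∘ fun i : Fin n => cellLabel s (X i)) := fun β => hγ ▸ hL₀.2 ⟨β, rfl⟩
  have hγY : quad (precision q L ρ n) (Y - γ ∘ fun i : Fin n => cellLabel s (X i)) ≤
      quad (precision q L ρ n) Y := by
    have e : Y - (0 : LevelNode k → ℝ) ∘ (fun i : Fin n => cellLabel s (X i)) = Y := by
      funext i; simp
    simpa [e] using hγmin 0
  -- Only coefficients from before the last split occur, and their nodes all hold the share `κ`; the
  -- size of the children plays no role.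
  have hcoef : ∀ p, |γ p| ≤ √(4 * R ^ 2 * B / (ξ * κ)) := fun p =>
    Real.abs_le_sqrt (coeff_sq_le hsymm hξ hκ hn hlow hup (by positivity)
      (h.sum_response_sq_le hm) hγY (h.card_cellLabel hs p))
  have hgain := loss_sub_loss_refineLabel_le hsymm hξ hlow hγmin hL₁ (S := cnt b')
    (S' := cnt !b') rfl rfl hle
  rw [hγ] at hgain
  set e : Fin n → ℝ := fun i => if i ∈ cnt b' then (1 : ℝ) else 0 with he
  set y := e ⬝ᵥ (precision q L ρ n *ᵥ (Y - γ ∘ fun i : Fin n => cellLabel s (X i))) with hy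
  set c : ℝ := ((cnt b').card : ℝ) with hc
  have hc0 : 0 ≤ c := Nat.cast_nonneg _
  -- regression part and noise part of the residual sum
  set g : Fin n → ℝ := fun i => m (X i) - γ (cellLabel s (X i)) with hg
  have hysplit : y = e ⬝ᵥ (precision q L ρ n *ᵥ fun i : Fin n => w i)
      + e ⬝ᵥ (precision q L ρ n *ᵥ g) := by
    rw [hy, ← dotProduct_add, ← Matrix.mulVec_add]
    congr 2
    funext i
    simp only [hY, hg, Pi.sub_apply, Pi.add_apply, Function.comp_apply]
    ring
  have hg_le : ∀ i, |g i| ≤ a := fun i => by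
    have h1 := hm _ (h.mem_cube i i.2)
    have h2 := hcoef (cellLabel s (X i))
    exact (abs_sub _ _).trans (add_le_add h1 h2)
  have hreg : |e ⬝ᵥ (precision q L ρ n *ᵥ g)| ≤ R ^ 2 * a * c :=
    abs_indicator_dotProduct_le hrow ha0 hg_le _
  have hnoise1 : |e ⬝ᵥ (precision q L ρ n *ᵥ fun i : Fin n => w i)| ≤ R ^ 2 * E * c :=
    abs_indicator_dotProduct_le hrow hE (fun i => h.abs_le i i.2) _
  have hnoise2 : |e ⬝ᵥ (precision q L ρ n *ᵥ fun i : Fin n => w i)|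
      ≤ R ^ 2 * ((c + √n * E) + q * E) := by
    have hI := fun i => h.mem_boxIndex_childBox s x b' i
    set I := boxIndex n X (childBox s (cellLabel s x) b') with hIdef
    have he' : e = fun i : Fin n => if (i : ℕ) ∈ I then (1 : ℝ) else 0 := by
      funext i
      simp only [he, hI, hcnt, Finset.mem_filter, Finset.mem_univ, true_and]
    have hcI : (I.card : ℝ) = c := by
      rw [hc, ← Finset.card_image_of_injective (cnt b') Fin.val_injective]
      congr 2
      ext i
      simp only [Finset.mem_image]
      constructor
      · intro hi
        have hin : i < n := Finset.mem_range.1 (boxIndex_subset _ _ hi)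
        refine ⟨⟨i, hin⟩, ?_, rfl⟩
        simp only [hcnt, Finset.mem_filter, Finset.mem_univ, true_and]
        exact (hI ⟨i, hin⟩).1 hi
      · rintro ⟨j, hj, rfl⟩
        simp only [hcnt, Finset.mem_filter, Finset.mem_univ, true_and] at hj
        exact (hI j).2 hj
    rw [he']
    refine abs_indicator_precision_le I h.abs_le hE (by positivity) fun a' b'' => ?_
    rw [← hcI]
    exact h.abs_sum_le _ a' b''
  have hK0 : 0 ≤ R ^ 2 := by positivity
  have hq0 : (0 : ℝ) ≤ q := Nat.cast_nonneg q
  have hRq : R ^ 2 ≤ R ^ 2 * (q + 1) := by nlinarith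
  have hy1 : |y| ≤ (R ^ 2 * (q + 1)) * (c * (E + a)) := by
    rw [hysplit]
    refine (abs_add_le _ _).trans ?_
    have : R ^ 2 * (c * (E + a)) ≤ R ^ 2 * (q + 1) * (c * (E + a)) :=
      mul_le_mul_of_nonneg_right hRq (by positivity)
    linarith
  have hy2 : |y| ≤ (R ^ 2 * (q + 1)) * (c * (1 + a) + √n * E) := by
    rw [hysplit]
    refine (abs_add_le _ _).trans ?_
    have h1 : R ^ 2 * (c * (1 + a)) ≤ R ^ 2 * (q + 1) * (c * (1 + a)) :=
      mul_le_mul_of_nonneg_right hRq (by positivity)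
    have h2 : R ^ 2 * (q * E) ≤ R ^ 2 * (q * (√n * E)) := by
      have : E ≤ √n * E := by nlinarith
      gcongr
    linarith
  refine hgain.trans ((sq_div_card_le hξ (by positivity) hE ha0 hnR hc0 hy1 hy2).trans ?_)
  have hsq : n * (E / √n) = √n * E := by
    have : (n : ℝ) = √n * √n := (Real.mul_self_sqrt hnR.le).symm
    field_simp
    rw [Real.sq_sqrt hnR.le]
    ring
  have h3 : (2 + a) ^ 2 * c + (E + a) ^ 2 * (√n * E) ≤
      n * ((2 + a) ^ 2 * η + (E + a) ^ 2 * (E / √n)) := by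
    rw [← hsq]
    have : (2 + a) ^ 2 * c ≤ (2 + a) ^ 2 * (η * n) := by gcongr
    linarith
  calc _ ≤ 2 * (R ^ 2 * (q + 1)) ^ 2 / ξ * (n * ((2 + a) ^ 2 * η + (E + a) ^ 2 * (E / √n))) :=
        mul_le_mul_of_nonneg_left h3 (by positivity)
    _ = _ := by ring

end Gain

/-! ### Oscillation of the criterion on a good sample. -/

section Oscillation

variable {D k q n : ℕ} {L : Matrix (Fin q) (Fin q) ℝ} {ρ : Fin (q + 1) → ℝ}
  {X : ℕ → Fin D → ℝ} {w : ℕ → ℝ} {ε σ E κ δ θ : ℝ}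

lemma card_fiber_le {ι : Type*} [DecidableEq ι] (f g : Fin n → ι) (l : ι) :
    (Finset.univ.filter fun i => f i = l).card ≤
      (Finset.univ.filter fun i => g i = l).card + (Finset.univ.filter fun i => f i ≠ g i).card := by
  refine (Finset.card_le_card fun i hi => ?_).trans (Finset.card_union_le _ _)
  simp only [Finset.mem_union, Finset.mem_filter, Finset.mem_univ, true_and] at hi ⊢
  by_cases hc : f i = g i
  · exact Or.inl (hc ▸ hi)
  · exact Or.inr hc

/-- On a good sample the criterion hardly changes between close vectors of splits. -/
lemma GoodSample.abs_dart_sub_le (h : GoodSample D k q n X w ε σ E κ δ θ) {ξ : ℝ} (hξ : 0 < ξ)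
    (hn : 0 < n) (hE : 0 ≤ E) (hσ : 0 ≤ σ) (hδ : δ < 1)
    (hdiag : DiagDominant (precision q L ρ n) ξ)
    {m : (Fin D → ℝ) → ℝ} {M : ℝ} (hm : ∀ z ∈ cube D, |m z| ≤ M)
    {x : Fin D → ℝ} (hx : x ∈ cube D) {s t : SplitVector D k}
    (hs : s ∈ wideSplits D k ε) (ht : t ∈ wideSplits D k ε) (hst : SameNode x s t)
    (hd : splitDist s t ≤ δ) {η τ R B a : ℝ} (hη : 0 < η) (hηκ : η ≤ κ) (hτ : 0 < τ)
    (hR : R = choleskyBound q L ρ) (hB : B = 2 * M ^ 2 + 2 * σ)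
    (ha : a = M + √(4 * R ^ 2 * B / (ξ * κ)))
    (hθη : Fintype.card (Option (InnerNode k)) * θ ≤ η) :
    |dart (precision q L ρ n) (fun i : Fin n => X i) (fun i : Fin n => m (X i) + w i) x s
      - dart (precision q L ρ n) (fun i : Fin n => X i) (fun i : Fin n => m (X i) + w i) x t| ≤
      2 * (R ^ 2 * (q + 1)) ^ 2 / ξ *
        ((2 + a) ^ 2 * (2 * η) + (E + a) ^ 2 * (E / √n)) +
      2 * (τ * (R ^ 2 * B) + (1 + 1 / τ) * (R ^ 2 * (4 * (4 * R ^ 2 * B / (ξ * η)) *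
        (Fintype.card (Option (InnerNode k)) * θ)))) := by
  classical
  have hκ : 0 < κ := hη.trans_le hηκ
  have hM : 0 ≤ M := (abs_nonneg _).trans (hm x hx)
  have hB0 : 0 ≤ B := by rw [hB]; positivity
  have ha0 : 0 ≤ a := by rw [ha]; positivity
  have hnR : (0 : ℝ) < n := by exact_mod_cast hn
  set Θ : ℝ := Fintype.card (Option (InnerNode k)) * θ with hΘ
  set Q := precision q L ρ n with hQ
  set Xn : Fin n → Fin D → ℝ := fun i => X i with hXn
  set Y : Fin n → ℝ := fun i => m (X i) + w i with hY
  have hsymm : Q.IsSymm := precision_isSymm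
  have hlow := fun v => hdiag.le_quad hsymm v
  have hrow := precision_row_sum_le (q := q) (L := L) (ρ := ρ) (n := n)
  rw [← hR] at hrow
  have hup := quad_le hsymm hrow
  have hpos : ∀ v, v ≠ 0 → 0 < quad Q v := by
    intro v hv
    refine lt_of_lt_of_le (mul_pos hξ ?_) (hlow v)
    obtain ⟨i, hi⟩ := Function.ne_iff.1 hv
    exact Finset.sum_pos' (fun _ _ => sq_nonneg _) ⟨i, Finset.mem_univ _, by
      have : v i ≠ 0 := hi
      positivity⟩
  have hXc : ∀ i, Xn i ∈ cube D := fun i => h.mem_cube i i.2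
  have hYB : ∑ i, Y i ^ 2 ≤ B * n := hB ▸ h.sum_response_sq_le hm
  have hs0 := glsLoss_cell_isLeast hsymm hpos hXc Y s
  have ht0 := glsLoss_cell_isLeast hsymm hpos hXc Y t
  have hs1 := glsLoss_childCell_isLeast hsymm hpos hXc Y hx s
  have ht1 := glsLoss_childCell_isLeast hsymm hpos hXc Y hx t
  have hbad := h.card_childLabel_ne_le hδ hd hx hst
  rw [← hΘ] at hbad
  have hp := cellLabel_eq_of_sameNode hx hst
  have hΘ0 : 0 ≤ Θ := by
    have := (Nat.cast_nonneg _).trans hbad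
    exact nonneg_of_mul_nonneg_left this hnR
  have hA0 : 0 ≤ 2 * (R ^ 2 * (q + 1)) ^ 2 / ξ *
        ((2 + a) ^ 2 * (2 * η) + (E + a) ^ 2 * (E / √n)) := by positivity
  have hC0 : 0 ≤ τ * (R ^ 2 * B) + (1 + 1 / τ) * (R ^ 2 * (4 * (4 * R ^ 2 * B / (ξ * η)) * Θ)) := by
    positivity
  set A := 2 * (R ^ 2 * (q + 1)) ^ 2 / ξ *
        ((2 + a) ^ 2 * (2 * η) + (E + a) ^ 2 * (E / √n)) with hAdef
  set C := τ * (R ^ 2 * B) + (1 + 1 / τ) * (R ^ 2 * (4 * (4 * R ^ 2 * B / (ξ * η)) * Θ)) with hC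
  unfold dart
  set s0 := glsLoss Q (membership Xn (cell s)) Y
  set t0 := glsLoss Q (membership Xn (cell t)) Y
  set s1 := glsLoss Q (membership Xn (childCell x s)) Y
  set t1 := glsLoss Q (membership Xn (childCell x t)) Y
  rw [← mul_sub, abs_mul, abs_of_nonneg (by positivity : (0 : ℝ) ≤ 1 / n), one_div,
    inv_mul_le_iff₀ hnR]
  -- the numbers of observations in a child of the divided node
  set ns : Bool → ℕ := fun b => (Finset.univ.filter fun i : Fin n =>
    childLabel Xn x s i = (cellLabel s x, b)).card with hns
  set nt : Bool → ℕ := fun b => (Finset.univ.filter fun i : Fin n =>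
    childLabel Xn x t i = (cellLabel t x, b)).card with hnt
  have hst' : ∀ b, (ns b : ℝ) ≤ nt b + Θ * n := fun b => by
    have := card_fiber_le (childLabel Xn x s) (childLabel Xn x t) (cellLabel s x, b)
    have h2 := (Nat.cast_le (α := ℝ)).2 this
    push_cast at h2
    rw [hns, hnt, ← hp]
    linarith
  have hts' : ∀ b, (nt b : ℝ) ≤ ns b + Θ * n := fun b => by
    have := card_fiber_le (childLabel Xn x t) (childLabel Xn x s) (cellLabel s x, b)
    have h2 := (Nat.cast_le (α := ℝ)).2 this
    simp only [ne_comm (a := childLabel Xn x t _)] at h2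
    push_cast at h2
    rw [hns, hnt, ← hp]
    linarith
  have hΘη : Θ * n ≤ η * n := mul_le_mul_of_nonneg_right hθη hnR.le
  have hs10 : s1 ≤ s0 := loss_refineLabel_le hs0 hs1
  have ht10 : t1 ≤ t0 := loss_refineLabel_le ht0 ht1
  -- The child counts of `s` and `t` differ by at most `η * n`. Hence either some child is small for
  -- both, and both gains are small, or all children hold at least `η * n` observations and the
  -- losses can be compared directly.
  by_cases hsmall : ∃ b, (ns b : ℝ) ≤ 2 * η * n ∧ (nt b : ℝ) ≤ 2 * η * n
  · obtain ⟨b, hb1, hb2⟩ := hsmall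
    have g1 := h.gain_le hξ hn hE hκ hlow hm hM hs hs0 hs1 hb1
    have g2 := h.gain_le hξ hn hE hκ hlow hm hM ht ht0 ht1 hb2
    rw [← hR, ← hB, ← ha, ← hAdef] at g1 g2
    have : 0 ≤ n * (2 * C) := by positivity
    rw [_root_.abs_le]
    constructor <;> linarith
  · push Not at hsmall
    have hsb : ∀ b, η * n ≤ ns b := fun b => by
      by_contra hlt
      have h1 := hsmall b (by nlinarith [not_le.1 hlt])
      have := hts' b
      linarith [not_le.1 hlt]
    have htb : ∀ b, η * n ≤ nt b := fun b => by
      by_contra hlt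
      have h1 : ¬ (ns b : ℝ) ≤ 2 * η * n := fun h1 => by
        have := hsmall b h1
        nlinarith [not_le.1 hlt]
      have := hst' b
      linarith [not_le.1 hlt]
    have hκn : η * n ≤ κ * n := mul_le_mul_of_nonneg_right hηκ hnR.le
    have d0 : |s0 - t0| ≤ n * C := by
      refine abs_loss_sub_le hsymm hξ hη hτ hn hlow hup (by positivity) hB0 hYB hs0 ht0
        (V := Set.univ) (fun p _ => hκn.trans (h.card_cellLabel hs p))
        (fun p _ => hκn.trans (h.card_cellLabel ht p)) (fun _ => trivial) (fun _ => trivial)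
        (le_trans (Nat.cast_le.2 (Finset.card_le_card fun i hi => ?_)) hbad)
      simp only [Finset.mem_filter, Finset.mem_univ, true_and] at hi ⊢
      exact fun hc => hi (congrArg Prod.fst hc)
    have d1 : |s1 - t1| ≤ n * C := by
      refine abs_loss_sub_le hsymm hξ hη hτ hn hlow hup (by positivity) hB0 hYB hs1 ht1
        -- The remaining labels of `refineLabel` have empty classes and must be excluded.
        (V := {l | l.1 = cellLabel s x ∨ l.2 = false}) ?_ ?_ ?_ ?_ hbad
      · rintro ⟨p, b⟩ hl
        by_cases hpp : p = cellLabel s x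
        · subst hpp; exact hsb b
        · obtain rfl : b = false := hl.resolve_left hpp
          exact hκn.trans (h.card_childLabel_of_ne hs x hpp)
      · rintro ⟨p, b⟩ hl
        by_cases hpp : p = cellLabel s x
        · subst hpp; rw [hp]; exact htb b
        · obtain rfl : b = false := hl.resolve_left hpp
          exact hκn.trans (h.card_childLabel_of_ne ht x (hp ▸ hpp))
      · intro i
        by_cases hc : cellLabel s (Xn i) = cellLabel s x
        · exact Or.inl hc
        · exact Or.inr (by simp [childLabel, refineLabel, hc])
      · intro i
        by_cases hc : cellLabel t (Xn i) = cellLabel t x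
        · exact Or.inl (hc.trans hp.symm)
        · exact Or.inr (by simp [childLabel, refineLabel, hc])
    have : 0 ≤ n * A := by positivity
    rw [_root_.abs_le] at d0 d1 ⊢
    constructor <;> linarith

end Oscillation

/-! ### Shares of observations in fixed regions. -/

section LawOfLargeNumbers

variable {Ω : Type*} [MeasurableSpace Ω] {μ : Measure Ω} [IsProbabilityMeasure μ] {D : ℕ}
  {X : ℕ → Ω → (Fin D → ℝ)}

/-- The weak law of large numbers for the share of observations in a region. -/
lemma tendsto_measure_countIn (hXm : ∀ i, Measurable (X i)) (hXind : iIndepFun X μ)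
    (hXunif : ∀ i, μ.map (X i) = volume.restrict (cube D)) {S : Set (Fin D → ℝ)}
    (hS : MeasurableSet S) {r : ℝ} (hr : 0 < r) :
    Tendsto (fun n : ℕ => μ {ω | r ≤ |(countIn n (fun i => X i ω) S : ℝ) / n
      - (volume.restrict (cube D)).real S|}) atTop (nhds 0) := by
  classical
  set g : (Fin D → ℝ) → ℝ := S.indicator 1 with hg
  have hgm : Measurable g := measurable_one.indicator hS
  set Z : ℕ → Ω → ℝ := fun i ω => g (X i ω) with hZ
  have hZm : ∀ i, Measurable (Z i) := fun i => hgm.comp (hXm i)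
  have hint : Integrable (Z 0) μ := by
    refine Integrable.of_bound (hZm 0).aestronglyMeasurable 1 (Eventually.of_forall fun ω => ?_)
    simp only [hZ, hg, Set.indicator_apply]
    split_ifs <;> simp
  have hind : Pairwise (Function.onFun (IndepFun · · μ) Z) := fun i j hij =>
    (hXind.indepFun hij).comp hgm hgm
  have hid : ∀ i, IdentDistrib (Z i) (Z 0) μ μ := fun i =>
    IdentDistrib.comp ⟨(hXm i).aemeasurable, (hXm 0).aemeasurable, by rw [hXunif, hXunif]⟩ hgm
  have hmean : ∫ ω, Z 0 ω ∂μ = (volume.restrict (cube D)).real S := by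
    rw [← hXunif 0, ← integral_indicator_one hS,
      integral_map (hXm 0).aemeasurable hgm.aestronglyMeasurable]
  have hsum : ∀ n ω, (countIn n (fun i => X i ω) S : ℝ) = ∑ i ∈ Finset.range n, Z i ω := by
    intro n ω
    simp [countIn, hZ, hg, Set.indicator_apply]
  have hlln := strong_law_ae_real Z hint hind hid
  rw [hmean] at hlln
  have hmeas := tendstoInMeasure_of_tendsto_ae
    (f := fun (n : ℕ) ω => (∑ i ∈ Finset.range n, Z i ω) / n)
    (g := fun _ => (volume.restrict (cube D)).real S)
    (fun n => ((Finset.measurable_fun_sum _ fun i _ => hZm i).div_const _).aestronglyMeasurable)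
    hlln
  rw [tendstoInMeasure_iff_norm] at hmeas
  simpa only [hsum, Real.norm_eq_abs] using hmeas r hr

lemma measurableSet_cube : MeasurableSet (cube D) := measurableSet_Icc

lemma measurableSet_slab (d : Fin D) (c δ : ℝ) : MeasurableSet (slab d c δ) :=
  measurableSet_Icc.preimage (measurable_pi_apply d)

lemma measurableSet_gridCube {N : ℕ} (j : Fin D → Fin N) : MeasurableSet (gridCube N j) :=
  measurableSet_Icc

lemma volume_real_gridCube {N : ℕ} (hN : 0 < N) (j : Fin D → Fin N) :
    (volume.restrict (cube D)).real (gridCube N j) = (1 / (N : ℝ)) ^ D := by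
  have hN0 : (0 : ℝ) < N := by exact_mod_cast hN
  have hsub : gridCube N j ⊆ cube D := by
    refine Set.Icc_subset_Icc (fun d => ?_) fun d => ?_
    · simp only [Pi.zero_apply]; positivity
    · rw [Pi.one_apply, div_le_one hN0]
      exact_mod_cast (j d).2
  rw [measureReal_restrict_apply (measurableSet_gridCube j), Set.inter_eq_left.2 hsub,
    Measure.real, gridCube, Real.volume_Icc_pi_toReal]
  · simp [← sub_div]
  · intro d
    simp only
    gcongr
    linarith

lemma volume_real_slab_le (d : Fin D) (c : ℝ) {δ : ℝ} (hδ : 0 ≤ δ) :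
    (volume.restrict (cube D)).real (slab d c δ) ≤ δ := by
  rw [measureReal_restrict_apply (measurableSet_slab d c δ)]
  have hle : Function.update (0 : Fin D → ℝ) d c ≤ Function.update (1 : Fin D → ℝ) d (c + δ) := by
    intro i
    by_cases h : i = d
    · subst h; simp [hδ]
    · simp [h]
  have hsub : slab d c δ ∩ cube D ⊆
      Set.Icc (Function.update (0 : Fin D → ℝ) d c) (Function.update (1 : Fin D → ℝ) d (c + δ)) := by
    rintro z ⟨⟨h1, h2⟩, h3, h4⟩
    refine ⟨fun i => ?_, fun i => ?_⟩
    · by_cases h : i = d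
      · subst h; simpa using h1
      · simpa [h] using h3 i
    · by_cases h : i = d
      · subst h; simpa using h2
      · simpa [h] using h4 i
  refine (measureReal_mono hsub ?_).trans ?_
  · exact isCompact_Icc.measure_ne_top
  · rw [Measure.real, Real.volume_Icc_pi_toReal hle, Finset.prod_eq_single d]
    · simp
    · intro i _ hi; simp [hi]
    · simp

end LawOfLargeNumbers

lemma measure_exists_notMem_cube {Ω : Type*} [MeasurableSpace Ω] {μ : Measure Ω} {D : ℕ}
    {X : ℕ → Ω → (Fin D → ℝ)} (hXm : ∀ i, Measurable (X i))
    (hXunif : ∀ i, μ.map (X i) = volume.restrict (cube D)) : μ {ω | ∃ i, X i ω ∉ cube D} = 0 := by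
  have : {ω | ∃ i, X i ω ∉ cube D} = ⋃ i, X i ⁻¹' (cube D)ᶜ := by
    ext; simp
  rw [this, measure_iUnion_null_iff]
  intro i
  rw [← Measure.map_apply (hXm i) measurableSet_cube.compl, hXunif i,
    Measure.restrict_apply measurableSet_cube.compl, Set.compl_inter_self, measure_empty]

/-! ### Finitely many index sets suffice for all half-space constraints. -/

section DataBoxes

variable {D n : ℕ}

/-- The half-spaces bounded by a coordinate of one of the observations (or by infinity). -/
def dataSide (X : ℕ → Fin D → ℝ) (d : Fin D) (o : Option (Fin n)) (b : Bool) :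
    Set (Fin D → ℝ) :=
  match o with
  | none => {_z | b = false}
  | some j => side (d, X j d) b

/-- On a finite sample every half-space agrees with one bounded by an observation. -/
lemma exists_dataSide (X : ℕ → Fin D → ℝ) (s : Split D) :
    ∃ o : Option (Fin n), ∀ i < n, ∀ b, X i ∈ side s b ↔ X i ∈ dataSide X s.1 o b := by
  classical
  rcases (Finset.univ.filter fun i : Fin n => s.2 ≤ X i s.1).eq_empty_or_nonempty with he | hne
  · refine ⟨none, fun i hi b => ?_⟩
    have : ¬ s.2 ≤ X i s.1 := fun h => by
      have : (⟨i, hi⟩ : Fin n) ∈ (∅ : Finset (Fin n)) := he ▸ by simpa using h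
      simp at this
    cases b
    · simpa [dataSide, mem_side_false] using this
    · simpa [dataSide, mem_side_true] using this
  · obtain ⟨j, hj, hmin⟩ := Finset.exists_min_image _ (fun i : Fin n => X i s.1) hne
    simp only [Finset.mem_filter, Finset.mem_univ, true_and] at hj hmin
    refine ⟨some j, fun i hi b => mem_side_congr (t := (s.1, X j s.1)) ?_ b⟩
    -- The cutoff moves up to the smallest observed coordinate that is not below it, so no
    -- observation changes side. With no such coordinate, `none` plays the role of an infinite
    -- cutoff.
    exact ⟨fun h => hmin ⟨i, hi⟩ h, fun h => hj.trans h⟩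

open Classical in
/-- Index sets cut out by half-spaces bounded by observations. -/
noncomputable def dataBox {κ : Type*} (n : ℕ) (T : κ → (Fin D × Option (Fin n)) × Bool)
    (X : ℕ → Fin D → ℝ) : Finset ℕ :=
  (Finset.range n).filter fun i => ∀ o, X i ∈ dataSide X (T o).1.1 (T o).1.2 (T o).2

lemma exists_dataBox_eq {κ : Type*} (X : ℕ → Fin D → ℝ) (T : κ → Split D × Bool) :
    ∃ T' : κ → (Fin D × Option (Fin n)) × Bool, boxIndex n X T = dataBox n T' X := by
  classical
  choose o ho using fun c => exists_dataSide (n := n) X (T c).1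
  refine ⟨fun c => (((T c).1.1, o c), (T c).2), Finset.filter_congr fun i hi => ?_⟩
  exact forall_congr' fun c => ho c i (Finset.mem_range.1 hi) _

/-- Once the bounding observations are fixed, membership only compares coordinates of pairs of
observations. This measurability in the covariates is what independence from the errors requires. -/
lemma measurableSet_dataBox_eq {κ : Type*} [Countable κ]
    (T : κ → (Fin D × Option (Fin n)) × Bool) (S : Finset ℕ) :
    MeasurableSet {X : ℕ → Fin D → ℝ | dataBox n T X = S} := by
  have hmem : ∀ i, MeasurableSet {X : ℕ → Fin D → ℝ | i ∈ dataBox n T X} := by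
    intro i
    have : {X : ℕ → Fin D → ℝ | i ∈ dataBox n T X} = {_X | i < n} ∩
        ⋂ o, {X | X i ∈ dataSide X (T o).1.1 (T o).1.2 (T o).2} := by
      ext X; simp [dataBox]
    rw [this]
    refine (MeasurableSet.const _).inter (MeasurableSet.iInter fun o => ?_)
    have hcoord : ∀ (i : ℕ) (d : Fin D), Measurable fun X : ℕ → Fin D → ℝ => X i d :=
      fun i d => (measurable_pi_apply d).comp (measurable_pi_apply i)
    rcases h : (T o).1.2 with _ | j
    · exact MeasurableSet.const _
    · cases hb : (T o).2
      · exact measurableSet_lt (hcoord i _) (hcoord j _)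
      · exact measurableSet_le (hcoord j _) (hcoord i _)
  have : {X : ℕ → Fin D → ℝ | dataBox n T X = S} =
      ⋂ i, {X | i ∈ dataBox n T X ↔ i ∈ S} := by
    ext X; simp [Finset.ext_iff]
  rw [this]
  refine MeasurableSet.iInter fun i => ?_
  by_cases hi : i ∈ S
  · simpa [hi] using hmem i
  · convert (hmem i).compl using 1
    ext X
    simp [hi]

end DataBoxes

/-! ### Uniform concentration of error sums over covariate-dependent index sets. -/

section Chaining

variable {Ω : Type*} [MeasurableSpace Ω] {μ : Measure Ω} {D : ℕ}
  {X : ℕ → Ω → (Fin D → ℝ)} {err : ℕ → Ω → ℝ}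

/-- The concentration of averages holds uniformly over all index sets of a given size. -/
lemma ExpAverageTail.exists_forall (h : ExpAverageTail μ err) :
    ∃ C : ℝ, 0 < C ∧ ∃ c : ℝ, 0 < c ∧ ∀ (n : ℕ) (I : Finset ℕ), I ⊆ Finset.range n → I.Nonempty →
      μ.real {ω | (I.card : ℝ) < |∑ i ∈ I, err i ω|} ≤ C * Real.exp (-c * I.card) := by
  obtain ⟨C, hC, c, hc, hI⟩ := h.1 1 one_pos
  refine ⟨C, hC, c, hc, fun n I hsub hne => ?_⟩
  -- The constants do not depend on the sequence of index sets, and the tail bound holds at every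
  -- index. A single set is therefore placed at index `n` of a sequence whose cardinalities diverge.
  set J : ℕ → Finset ℕ := fun j => if j = n then I else Finset.range j with hJ
  have h1 := hI J ?_ ?_ n
  · have hJn : J n = I := by simp [hJ]
    rw [hJn] at h1
    have hpos : (0 : ℝ) < I.card := by exact_mod_cast hne.card_pos
    convert h1 using 3
    ext ω
    rw [one_div, lt_inv_mul_iff₀ hpos, mul_one]
  · intro j
    simp only [hJ]
    split_ifs with h
    · rwa [h]
    · exact subset_rfl
  · refine tendsto_atTop_mono' _ ?_ tendsto_id
    filter_upwards [eventually_gt_atTop n] with j hj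
    simp [hJ, hj.ne']

variable [IsProbabilityMeasure μ]

/-- A random index set that depends on the covariates only inherits the concentration. -/
lemma measure_random_index_le (hXm : ∀ i, Measurable (X i))
    (hindep : IndepFun (fun ω i => X i ω) (fun ω i => err i ω) μ) {C c : ℝ} (hC : 0 ≤ C)
    (hc : 0 ≤ c) {n : ℕ} (hn : 0 < n)
    (htail : ∀ I : Finset ℕ, I ⊆ Finset.range n → I.Nonempty →
      μ.real {ω | (I.card : ℝ) < |∑ i ∈ I, err i ω|} ≤ C * Real.exp (-c * I.card))
    (F : (ℕ → Fin D → ℝ) → Finset ℕ) (hF : ∀ S, MeasurableSet {x | F x = S})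
    (hFn : ∀ x, F x ⊆ Finset.range n) :
    μ {ω | √n ≤ (F fun i => X i ω).card ∧
      ((F fun i => X i ω).card : ℝ) < |∑ i ∈ F fun i => X i ω, err i ω|}
      ≤ ENNReal.ofReal (C * Real.exp (-c * √n)) := by
  classical
  set P := (Finset.range n).powerset.filter fun S => √n ≤ (S.card : ℝ) with hP
  set A : Finset ℕ → Set Ω := fun S => (fun ω i => X i ω) ⁻¹' {x | F x = S} with hA
  set B : Finset ℕ → Set (ℕ → ℝ) := fun S => {w | (S.card : ℝ) < |∑ i ∈ S, w i|} with hB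
  set b := ENNReal.ofReal (C * Real.exp (-c * √n)) with hb
  have hsq : (0 : ℝ) < √n := Real.sqrt_pos.2 (by exact_mod_cast hn)
  have hXmeas : Measurable fun ω i => X i ω := measurable_pi_lambda _ hXm
  have hBm : ∀ S, MeasurableSet (B S) := fun S => by
    refine measurableSet_lt measurable_const ?_
    exact continuous_abs.measurable.comp
      (Finset.measurable_fun_sum _ fun i _ => measurable_pi_apply i)
  have hsub : {ω | √n ≤ (F fun i => X i ω).card ∧
      ((F fun i => X i ω).card : ℝ) < |∑ i ∈ F fun i => X i ω, err i ω|} ⊆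
      ⋃ S ∈ P, A S ∩ (fun ω i => err i ω) ⁻¹' B S := by
    rintro ω ⟨h1, h2⟩
    simp only [Set.mem_iUnion]
    refine ⟨F fun i => X i ω, ?_, rfl, h2⟩
    simp only [hP, Finset.mem_filter, Finset.mem_powerset]
    exact ⟨hFn _, h1⟩
  -- On `A S` the random set is the fixed `S`, and independence factors the probability. The events
  -- `A S` are disjoint, so the sum over `S` costs no factor.
  have hbound : ∀ S ∈ P, μ (A S ∩ (fun ω i => err i ω) ⁻¹' B S) ≤ μ (A S) * b := by
    intro S hS
    simp only [hP, Finset.mem_filter, Finset.mem_powerset] at hS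
    rw [hA, hindep.measure_inter_preimage_eq_mul _ _ (hF S) (hBm S)]
    refine mul_le_mul_right ?_ _
    have hne : S.Nonempty := by
      rw [← Finset.card_pos]
      exact_mod_cast hsq.trans_le hS.2
    have h1 := htail S hS.1 hne
    have h2 : C * Real.exp (-c * S.card) ≤ C * Real.exp (-c * √n) := by
      refine mul_le_mul_of_nonneg_left (Real.exp_le_exp.2 ?_) hC
      nlinarith [hS.2]
    rw [hb, ← ofReal_measureReal]
    exact ENNReal.ofReal_le_ofReal (h1.trans h2)
  calc _ ≤ μ (⋃ S ∈ P, A S ∩ (fun ω i => err i ω) ⁻¹' B S) := measure_mono hsub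
    _ ≤ ∑ S ∈ P, μ (A S ∩ (fun ω i => err i ω) ⁻¹' B S) := measure_biUnion_finset_le _ _
    _ ≤ ∑ S ∈ P, μ (A S) * b := Finset.sum_le_sum hbound
    _ = (∑ S ∈ P, μ (A S)) * b := by rw [Finset.sum_mul]
    _ ≤ 1 * b := by
        refine mul_le_mul_left ?_ _
        rw [← measure_univ (μ := μ)]
        refine sum_measure_le_measure_univ (fun S _ => (hXmeas (hF S)).nullMeasurableSet) ?_
        intro S _ S' _ hne
        refine Disjoint.aedisjoint (Set.disjoint_left.2 fun ω h1 h2 => hne ?_)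
        exact Eq.trans (Eq.symm h1) h2
    _ = b := one_mul b

/-- Polynomially many sets of size at least `√n` do not disturb exponential concentration. -/
lemma tendsto_pow_mul_exp_neg_sqrt (K c C : ℝ) (hc : 0 < c) (p : ℕ) :
    Tendsto (fun n : ℕ => K * ((n : ℝ) + 1) ^ p * (C * Real.exp (-c * √n))) atTop (nhds 0) := by
  have h1 : Tendsto (fun n : ℕ => √(n : ℝ)) atTop atTop :=
    Real.tendsto_sqrt_atTop.comp tendsto_natCast_atTop_atTop
  have h2 := (tendsto_rpow_mul_exp_neg_mul_atTop_nhds_zero (2 * p : ℕ) c hc).comp h1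
  have h3 := h2.const_mul (|K| * |C| * 2 ^ p)
  rw [mul_zero] at h3
  refine squeeze_zero_norm' ?_ h3
  filter_upwards [eventually_ge_atTop 1] with n hn
  have hn' : (1 : ℝ) ≤ n := by exact_mod_cast hn
  have hsq : √(n : ℝ) ^ (2 * p) = (n : ℝ) ^ p := by
    rw [pow_mul, Real.sq_sqrt (by positivity)]
  have h4 : ((n : ℝ) + 1) ^ p ≤ 2 ^ p * (n : ℝ) ^ p := by
    rw [← mul_pow]
    gcongr
    linarith
  simp only [Function.comp_apply, Real.rpow_natCast, hsq]
  rw [norm_mul, norm_mul, norm_mul, Real.norm_eq_abs, Real.norm_eq_abs, Real.norm_eq_abs,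
    Real.norm_eq_abs, abs_of_nonneg (Real.exp_pos _).le,
    abs_of_nonneg (by positivity : (0 : ℝ) ≤ ((n : ℝ) + 1) ^ p)]
  calc |K| * ((n : ℝ) + 1) ^ p * (|C| * Real.exp (-c * √n))
      ≤ |K| * (2 ^ p * (n : ℝ) ^ p) * (|C| * Real.exp (-c * √n)) := by gcongr
    _ = _ := by ring

/-- With probability tending to one, the errors sum to at most the cardinality over all large
shifted boxes of observations. -/
lemma tendsto_measure_box_sums (hXm : ∀ i, Measurable (X i))
    (hindep : IndepFun (fun ω i => X i ω) (fun ω i => err i ω) μ)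
    (htail : ExpAverageTail μ err) (q : ℕ) (κ : Type) [Fintype κ] :
    Tendsto (fun n : ℕ => μ {ω | ∃ (T : κ → Split D × Bool) (a b : Fin (q + 1)),
      √n ≤ (shifted q n (boxIndex n (fun i => X i ω) T) a b).card ∧
      ((shifted q n (boxIndex n (fun i => X i ω) T) a b).card : ℝ) <
        |∑ j ∈ shifted q n (boxIndex n (fun i => X i ω) T) a b, err j ω|}) atTop (nhds 0) := by
  classical
  obtain ⟨C, hC, c, hc, hI⟩ := htail.exists_forall
  have hlim := ENNReal.tendsto_ofReal (tendsto_pow_mul_exp_neg_sqrt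
    ((D * 2 : ℝ) ^ Fintype.card κ * (q + 1) ^ 2) c C hc (Fintype.card κ))
  rw [ENNReal.ofReal_zero] at hlim
  refine tendsto_of_tendsto_of_tendsto_of_le_of_le' tendsto_const_nhds hlim
    (Eventually.of_forall fun _ => zero_le) ?_
  filter_upwards [eventually_gt_atTop 0] with n hn
  -- The union bound runs over this type, whose cardinality is polynomial in `n`.
  set Θ := (κ → (Fin D × Option (Fin n)) × Bool) × Fin (q + 1) × Fin (q + 1) with hΘ
  set F : Θ → (ℕ → Fin D → ℝ) → Finset ℕ := fun T x =>
    shifted q n (dataBox n T.1 x) T.2.1 T.2.2 with hF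
  set Bad : Θ → Set Ω := fun T => {ω | √n ≤ (F T fun i => X i ω).card ∧
      ((F T fun i => X i ω).card : ℝ) < |∑ i ∈ F T fun i => X i ω, err i ω|} with hBad
  have hsub : {ω | ∃ (T : κ → Split D × Bool) (a b : Fin (q + 1)),
      √n ≤ (shifted q n (boxIndex n (fun i => X i ω) T) a b).card ∧
      ((shifted q n (boxIndex n (fun i => X i ω) T) a b).card : ℝ) <
        |∑ j ∈ shifted q n (boxIndex n (fun i => X i ω) T) a b, err j ω|} ⊆ ⋃ T, Bad T := by
    rintro ω ⟨T, a, b, h⟩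
    obtain ⟨T', hT'⟩ := exists_dataBox_eq (n := n) (fun i => X i ω) T
    rw [hT'] at h
    exact Set.mem_iUnion.2 ⟨(T', a, b), h⟩
  have hFm : ∀ T S, MeasurableSet {x | F T x = S} := by
    intro T S
    have : {x | F T x = S} = ⋃ J ∈ {J : Finset ℕ | shifted q n J T.2.1 T.2.2 = S},
        {x | dataBox n T.1 x = J} := by
      ext x; simp [hF]
    rw [this]
    exact MeasurableSet.biUnion (Set.to_countable _) fun J _ => measurableSet_dataBox_eq _ _
  have hcard : (Fintype.card Θ : ℝ)
      = (D * 2 : ℝ) ^ Fintype.card κ * (q + 1) ^ 2 * ((n : ℝ) + 1) ^ Fintype.card κ := by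
    simp only [hΘ, Fintype.card_prod, Fintype.card_fun, Fintype.card_option, Fintype.card_fin,
      Fintype.card_bool]
    push_cast
    rw [mul_pow, mul_pow, mul_pow]
    ring
  calc _ ≤ μ (⋃ T, Bad T) := measure_mono hsub
    _ ≤ ∑ T, μ (Bad T) := measure_iUnion_fintype_le _ _
    _ ≤ ∑ _T : Θ, ENNReal.ofReal (C * Real.exp (-c * √n)) := Finset.sum_le_sum fun T _ =>
        measure_random_index_le hXm hindep hC.le hc.le hn (hI n) (F T) (hFm T)
          fun x => shifted_subset _ _ _
    _ = ENNReal.ofReal (Fintype.card Θ * (C * Real.exp (-c * √n))) := by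
        rw [Finset.sum_const, nsmul_eq_mul, Finset.card_univ,
          ENNReal.ofReal_mul (Nat.cast_nonneg _), ENNReal.ofReal_natCast]
    _ = _ := by rw [hcard]

end Chaining

/-! ### From finitely many grid conditions to a good sample. -/

section Sample

variable {D k q n : ℕ} {X : ℕ → Fin D → ℝ} {w : ℕ → ℝ}

/-- At most two grid slabs cover a thin slab inside the cube, so finitely many counts control all
cutoffs at once. -/
lemma countIn_slab_le {N : ℕ} (hN : 0 < N) {δ t : ℝ} (ht : 0 ≤ t) (hδ : δ * N ≤ 1)
    (hX : ∀ i < n, X i ∈ cube D)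
    (h : ∀ (d : Fin D) (j : Fin (N + 1)),
      (countIn n X (slab d ((j : ℕ) / (N : ℝ)) (1 / N)) : ℝ) ≤ t) (d : Fin D) (c : ℝ) :
    (countIn n X (slab d c δ) : ℝ) ≤ 2 * t := by
  classical
  set J := Finset.univ.filter fun j : Fin (N + 1) => (j : ℤ) = ⌊c * N⌋ ∨ (j : ℤ) = ⌊c * N⌋ + 1
    with hJ
  have hcard : J.card ≤ 2 := by
    rw [← Finset.card_image_of_injective J
      (f := fun j : Fin (N + 1) => ((j : ℕ) : ℤ)) fun a b hab => Fin.ext (Int.ofNat_inj.1 hab)]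
    refine (Finset.card_le_card (t := {⌊c * N⌋, ⌊c * N⌋ + 1}) fun a ha => ?_).trans
      Finset.card_le_two
    obtain ⟨j, hj, rfl⟩ := Finset.mem_image.1 ha
    simpa [hJ] using hj
  have hle : countIn n X (slab d c δ)
      ≤ ∑ j ∈ J, countIn n X (slab d ((j : ℕ) / (N : ℝ)) (1 / N)) := by
    refine (Finset.card_le_card fun i hi => ?_).trans Finset.card_biUnion_le
    simp only [Finset.mem_filter, Finset.mem_range, Finset.mem_biUnion] at hi ⊢
    have := slab_inter_cube_subset hN hδ d c ⟨hi.2, hX i hi.1⟩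
    simp only [Set.mem_iUnion] at this
    obtain ⟨j, hj, hz⟩ := this
    exact ⟨j, by simpa [hJ] using hj, hi.1, hz⟩
  calc (countIn n X (slab d c δ) : ℝ)
      ≤ ∑ j ∈ J, (countIn n X (slab d ((j : ℕ) / (N : ℝ)) (1 / N)) : ℝ) := by exact_mod_cast hle
    _ ≤ ∑ _j ∈ J, t := Finset.sum_le_sum fun j _ => h d j
    _ = J.card * t := by rw [Finset.sum_const, nsmul_eq_mul]
    _ ≤ 2 * t := mul_le_mul_of_nonneg_right (by exact_mod_cast hcard) ht

/-- Finitely many counting conditions on grids, together with the conditions on the errors,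
make a sample good. -/
lemma goodSample_of_grid {ε σ E : ℝ} {N₁ N₂ : ℕ} (hN₁ : 2 < ε * N₁) (hN₂ : 0 < N₂) {κ : ℝ}
    (hX : ∀ i < n, X i ∈ cube D) (hsq : ∑ i ∈ Finset.range n, w i ^ 2 ≤ σ * n)
    (hE : ∀ i < n, |w i| ≤ E) (hE0 : 0 ≤ E)
    (hcube : ∀ j : Fin D → Fin N₁, κ * n ≤ countIn n X (gridCube N₁ j))
    (hslab : ∀ (d : Fin D) (j : Fin (N₂ + 1)),
      (countIn n X (slab d ((j : ℕ) / (N₂ : ℝ)) (1 / N₂)) : ℝ) ≤ 2 / N₂ * n)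
    (hsum : ∀ (T : Option (Fin (k - 1)) → Split D × Bool) (a b : Fin (q + 1)),
      √n ≤ (shifted q n (boxIndex n X T) a b).card →
      |∑ j ∈ shifted q n (boxIndex n X T) a b, w j| ≤
        (shifted q n (boxIndex n X T) a b).card) :
    GoodSample D k q n X w ε σ E κ (1 / N₂) (4 / N₂) where
  mem_cube := hX
  sum_sq_le := hsq
  abs_le := hE
  le_count_cube a ha := by
    obtain ⟨j, hj⟩ := exists_gridCube_subset hN₁ ha
    exact (hcube j).trans (Nat.cast_le.2 (countIn_mono fun i _ hi => hj hi))
  count_slab_le d c := by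
    have hN : (0 : ℝ) < N₂ := by exact_mod_cast hN₂
    have := countIn_slab_le hN₂ (by positivity) (δ := 1 / (N₂ : ℝ))
      (by rw [one_div_mul_cancel hN.ne']) hX hslab d c
    refine this.trans (le_of_eq ?_)
    ring
  abs_sum_le T a b := by
    have hc : ((shifted q n (boxIndex n X T) a b).card : ℝ) ≤ (boxIndex n X T).card := by
      exact_mod_cast card_shifted_le _ a b
    have hs : 0 ≤ √n * E := by positivity
    rcases le_or_gt √n ((shifted q n (boxIndex n X T) a b).card : ℝ) with h | h
    · linarith [hsum T a b h]
    · have h1 : |∑ j ∈ shifted q n (boxIndex n X T) a b, w j|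
          ≤ (shifted q n (boxIndex n X T) a b).card * E := by
        rw [← nsmul_eq_mul, ← Finset.sum_const]
        refine (Finset.abs_sum_le_sum_abs _ _).trans (Finset.sum_le_sum fun j hj => hE j ?_)
        exact Finset.mem_range.1 (shifted_subset _ _ _ hj)
      have h2 := mul_le_mul_of_nonneg_right h.le hE0
      have h3 : (0 : ℝ) ≤ (boxIndex n X T).card := Nat.cast_nonneg _
      linarith

end Sample

/-! ### Asymptotics of the error term and choice of the parameters. -/

section Limits

/-- The small-child term with `E = C * √(log n)`: a cube of `√(log n)` against `√n`. Enlarging the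
cube to a fourth power makes it the square root of `log n ^ 4 / n`. -/
lemma tendsto_sqrt_log_cube_div_sqrt {C a : ℝ} (hC : 0 ≤ C) (ha : 0 ≤ a) :
    Tendsto (fun n : ℕ => (C * √(Real.log n) + a) ^ 2 * (C * √(Real.log n) / √n)) atTop
      (nhds 0) := by
  have h0 : Tendsto (fun n : ℕ => √(Real.log n ^ 4 / (n : ℝ))) atTop (nhds 0) := by
    have h := (Real.isLittleO_pow_log_id_atTop (n := 4)).tendsto_div_nhds_zero.comp
      tendsto_natCast_atTop_atTop
    have h' := (Real.continuous_sqrt.tendsto 0).comp h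
    rw [Real.sqrt_zero] at h'
    exact h'
  have h1 := h0.const_mul ((C + a) ^ 2 * C)
  rw [mul_zero] at h1
  refine squeeze_zero' (Eventually.of_forall fun n => by positivity) ?_ h1
  filter_upwards [(Real.tendsto_log_atTop.comp tendsto_natCast_atTop_atTop).eventually_ge_atTop 1]
    with n hn
  simp only [Function.comp_apply] at hn
  set l := Real.log n
  have hs1 : 1 ≤ √l := by rw [Real.one_le_sqrt]; exact hn
  have hl : √l ^ 2 = l := Real.sq_sqrt (by linarith)
  have e : √(l ^ 4 / (n : ℝ)) = √l ^ 4 / √n := by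
    rw [Real.sqrt_div (by positivity)]
    congr 1
    have h4 : l ^ 4 = (l ^ 2) ^ 2 := by ring
    have h5 : √l ^ 4 = (√l ^ 2) ^ 2 := by ring
    rw [h4, Real.sqrt_sq (by positivity), h5, hl]
  rw [e]
  have h2 : C * √l + a ≤ (C + a) * √l := by nlinarith
  have h3 : (C * √l + a) ^ 2 ≤ ((C + a) * √l) ^ 2 := pow_le_pow_left₀ (by positivity) h2 2
  have h4 : √l ^ 3 ≤ √l ^ 4 := pow_le_pow_right₀ hs1 (by norm_num)
  calc (C * √l + a) ^ 2 * (C * √l / √n) ≤ ((C + a) * √l) ^ 2 * (C * √l / √n) := by gcongr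
    _ = (C + a) ^ 2 * C * (√l ^ 3 / √n) := by ring
    _ ≤ (C + a) ^ 2 * C * (√l ^ 4 / √n) := by gcongr

/-- Suitable values of the threshold for small children, the constant in Young's inequality and
the mesh of the grid of slabs. -/
lemma exists_tuning {φ κ : ℝ} (hφ : 0 < φ) (hκ : 0 < κ) (ξ : ℝ) {G K B : ℝ}
    (hG : 0 ≤ G) (hKB : 0 ≤ K * B) (c : ℝ) :
    ∃ η τ : ℝ, ∃ N : ℕ, 0 < η ∧ η ≤ κ ∧ 0 < τ ∧ 1 < N ∧ G * η ≤ φ / 4 ∧ c * (4 / N) ≤ η ∧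
      2 * (τ * (K * B) + (1 + 1 / τ) * (K * (4 * (4 * K * B / (ξ * η)) * (c * (4 / N)))))
        ≤ φ / 2 := by
  set η := min κ (φ / (4 * (G + 1))) with hη
  have hη0 : 0 < η := lt_min hκ (by positivity)
  set τ := φ / (8 * (K * B + 1)) with hτ
  have hτ0 : 0 < τ := by positivity
  have hlim : ∀ A : ℝ, Tendsto (fun N : ℕ => A * (c * (4 / (N : ℝ)))) atTop (nhds 0) := by
    intro A
    have := ((tendsto_const_div_atTop_nhds_zero_nat (4 : ℝ)).const_mul c).const_mul A
    simpa using this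
  set A := (1 + 1 / τ) * (K * (4 * (4 * K * B / (ξ * η)))) with hA
  -- The mesh is chosen last, because the comparison error carries the factors `1 / η` and `1 + 1 /
  -- τ`.
  obtain ⟨N, h1, h2, h3⟩ := (((hlim 1).eventually (gt_mem_nhds hη0)).and
    (((hlim A).eventually (gt_mem_nhds (by positivity : (0 : ℝ) < φ / 8))).and
      (eventually_gt_atTop 1))).exists
  refine ⟨η, τ, N, hη0, min_le_left _ _, hτ0, h3, ?_, by linarith, ?_⟩
  · have h4 : η ≤ φ / (4 * (G + 1)) := min_le_right _ _
    rw [le_div_iff₀ (by positivity)] at h4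
    nlinarith
  · have h4 : τ * (K * B) ≤ φ / 8 := by
      have : τ * (8 * (K * B + 1)) = φ := by rw [hτ]; field_simp
      nlinarith
    have h5 : (1 + 1 / τ) * (K * (4 * (4 * K * B / (ξ * η)) * (c * (4 / N)))) ≤ φ / 8 := by
      refine le_trans (le_of_eq ?_) h2.le
      rw [hA]; ring
    linarith

end Limits

end DART

/-! ### Exceptional events and conclusion. -/

theorem proposition3 {Ω : Type*} [MeasurableSpace Ω] (μ : Measure Ω) [IsProbabilityMeasure μ]
    (D : ℕ)
    -- covariates: i.i.d. uniform on `[0,1]^D`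
    (X : ℕ → Ω → (Fin D → ℝ)) (hXm : ∀ i, Measurable (X i)) (hXind : iIndepFun X μ)
    (hXunif : ∀ i, μ.map (X i) = volume.restrict (DART.cube D))
    -- errors, independent of the covariates, with their tail behaviour
    (err : ℕ → Ω → ℝ) (herrm : ∀ i, Measurable (err i))
    (hindep : IndepFun (fun ω i => X i ω) (fun ω i => err i ω) μ)
    (htail_max : DART.LogMaxTail μ err) (htail_avg : DART.ExpAverageTail μ err)
    -- bounded regression function, responses `Y_i = m(X_i) + ε_i`
    (m : (Fin D → ℝ) → ℝ) (hm : Measurable m) (M₀ : ℝ) (hmM : ∀ z ∈ DART.cube D, |m z| ≤ M₀)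
    (Y : ℕ → Ω → ℝ) (hY : ∀ i ω, Y i ω = m (X i ω) + err i ω)
    -- working precision matrix: banded Cholesky factor and diagonal dominance
    (q : ℕ) (L : Matrix (Fin q) (Fin q) ℝ) (hL : ∀ i j, i < j → L i j = 0)
    (ρ : Fin (q + 1) → ℝ) (ξ : ℝ) (hξ : 0 < ξ)
    (hdiag : ∀ n, q < n → DART.DiagDominant (DART.precision q L ρ n) ξ)
    -- point, depth and margin
    (x : Fin D → ℝ) (hx : x ∈ DART.cube D) (k : ℕ) (hk : 1 ≤ k) (ε : ℝ) (hε : 0 < ε) :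
    ∀ φ : ℝ, 0 < φ → ∀ π : ℝ, 0 < π → ∃ δ : ℝ, 0 < δ ∧
      limsup (fun n : ℕ => μ {ω | ENNReal.ofReal φ <
        DART.dartModulus k (DART.precision q L ρ n) (fun i : Fin n => X i ω)
          (fun i : Fin n => Y i ω) x ε δ}) atTop ≤ ENNReal.ofReal π := by
  classical
  intro φ hφ π hπ
  obtain ⟨C, hC, n₀, hmax⟩ := htail_max π hπ
  obtain ⟨σ, hσ, C₂, hC₂, c₂, hc₂, hsq⟩ := htail_avg.2
  obtain ⟨N₁, hN₁⟩ : ∃ N₁ : ℕ, 2 < ε * N₁ := by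
    obtain ⟨N, hN⟩ := exists_nat_gt (2 / ε)
    exact ⟨N, by rwa [div_lt_iff₀' hε] at hN⟩
  have hN₁0 : 0 < N₁ := Nat.pos_of_ne_zero fun h => by simp [h] at hN₁; linarith
  have hN₁R : (0 : ℝ) < N₁ := by exact_mod_cast hN₁0
  -- Half the volume of a grid cube: a deviation of the empirical share below `κ` leaves a share of
  -- at least `κ`.
  set κ : ℝ := (1 / (N₁ : ℝ)) ^ D / 2 with hκ
  have hκ0 : 0 < κ := by positivity
  set R := DART.choleskyBound q L ρ with hR
  set B := 2 * M₀ ^ 2 + 2 * σ with hB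
  have hM : 0 ≤ M₀ := (abs_nonneg _).trans (hmM x hx)
  set a := M₀ + √(4 * R ^ 2 * B / (ξ * κ)) with ha
  set G₀ := 2 * (R ^ 2 * (q + 1)) ^ 2 / ξ with hG₀
  have hG₀0 : 0 ≤ G₀ := by positivity
  obtain ⟨η, τ, N, hη, hηκ, hτ, hN, htune₁, htune₂, htune₃⟩ := DART.exists_tuning hφ hκ0 ξ
    (G := G₀ * (2 + a) ^ 2 * 2) (K := R ^ 2) (B := B) (by positivity) (by positivity)
    (Fintype.card (Option (DART.InnerNode k)))
  have hN0 : 0 < N := by omega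
  have hNR : (0 : ℝ) < N := by exact_mod_cast hN0
  refine ⟨1 / N, by positivity, ?_⟩
  -- the exceptional events
  set B₁ : Set Ω := {ω | ∃ i, X i ω ∉ DART.cube D} with hB₁
  set B₂ : ℕ → Set Ω := fun n =>
    {ω | σ < 1 / (n : ℝ) * |∑ i ∈ Finset.range n, err i ω ^ 2|} with hB₂
  set B₃ : ℕ → Set Ω := fun n => {ω | ∀ i < n, |err i ω| ≤ C * √(Real.log n)}ᶜ with hB₃
  set B₄ : ℕ → (Fin D → Fin N₁) → Set Ω := fun n j =>
    {ω | κ ≤ |(DART.countIn n (fun i => X i ω) (DART.gridCube N₁ j) : ℝ) / n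
      - (volume.restrict (DART.cube D)).real (DART.gridCube N₁ j)|} with hB₄
  -- A grid slab has volume at most `1 / N`, so outside this event its share is below `2 / N`; two
  -- such slabs give the `4 / N` of the good sample.
  set B₅ : ℕ → Fin D × Fin (N + 1) → Set Ω := fun n j =>
    {ω | 1 / (N : ℝ) ≤ |(DART.countIn n (fun i => X i ω)
        (DART.slab j.1 ((j.2 : ℕ) / (N : ℝ)) (1 / N)) : ℝ) / n
      - (volume.restrict (DART.cube D)).real
        (DART.slab j.1 ((j.2 : ℕ) / (N : ℝ)) (1 / N))|} with hB₅
  set B₆ : ℕ → Set Ω := fun n => {ω | ∃ (T : Option (Fin (k - 1)) → DART.Split D × Bool)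
      (a b : Fin (q + 1)),
      √n ≤ (DART.shifted q n (DART.boxIndex n (fun i => X i ω) T) a b).card ∧
      ((DART.shifted q n (DART.boxIndex n (fun i => X i ω) T) a b).card : ℝ) <
        |∑ j ∈ DART.shifted q n (DART.boxIndex n (fun i => X i ω) T) a b, err j ω|} with hB₆
  -- outside of them the criterion is stable
  have hgood : ∀ᶠ n : ℕ in atTop, ∀ ω, ω ∉ B₁ → ω ∉ B₂ n → ω ∉ B₃ n → ω ∉ ⋃ j, B₄ n j →
      ω ∉ ⋃ j, B₅ n j → ω ∉ B₆ n →
      DART.dartModulus k (DART.precision q L ρ n) (fun i : Fin n => X i ω)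
          (fun i : Fin n => Y i ω) x ε (1 / N) ≤ ENNReal.ofReal φ := by
    have hlim := (DART.tendsto_sqrt_log_cube_div_sqrt hC.le
      (by positivity : 0 ≤ a)).const_mul G₀
    rw [mul_zero] at hlim
    filter_upwards [eventually_gt_atTop q, eventually_gt_atTop 0,
      hlim.eventually (gt_mem_nhds (by positivity : (0 : ℝ) < φ / 4))]
      with n hnq hn hsmall ω h₁ h₂ h₃ h₄ h₅ h₆
    have hnR : (0 : ℝ) < n := by exact_mod_cast hn
    simp only [hB₁, Set.mem_ofPred_eq, not_exists, not_not] at h₁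
    simp only [hB₂, Set.mem_ofPred_eq, not_lt] at h₂
    simp only [hB₃, Set.mem_compl_iff, Set.mem_ofPred_eq, not_not] at h₃
    simp only [hB₄, Set.mem_iUnion, Set.mem_ofPred_eq, not_exists, not_le] at h₄
    simp only [hB₅, Set.mem_iUnion, Set.mem_ofPred_eq, not_exists, not_le] at h₅
    simp only [hB₆, Set.mem_ofPred_eq, not_exists, not_and, not_lt] at h₆
    have hE0 : 0 ≤ C * √(Real.log n) := by positivity
    have hsample : DART.GoodSample D k q n (fun i => X i ω) (fun i => err i ω) ε σ
        (C * √(Real.log n)) κ (1 / N) (4 / N) := by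
      refine DART.goodSample_of_grid hN₁ hN0 (fun i _ => h₁ i) ?_ h₃ hE0 ?_ ?_ h₆
      · rw [one_div, inv_mul_le_iff₀ hnR] at h₂
        linarith [(le_abs_self _).trans h₂]
      · intro j
        have h := (abs_lt.1 (h₄ j)).1
        rw [DART.volume_real_gridCube hN₁0] at h
        have h' : κ < (DART.countIn n (fun i => X i ω) (DART.gridCube N₁ j) : ℝ) / n := by
          linarith
        rw [lt_div_iff₀ hnR] at h'
        exact h'.le
      · intro d j
        have h := (abs_lt.1 (h₅ (d, j))).2
        have hv := DART.volume_real_slab_le d ((j : ℕ) / (N : ℝ))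
          (by positivity : 0 ≤ 1 / (N : ℝ))
        have h' : (DART.countIn n (fun i => X i ω)
            (DART.slab d ((j : ℕ) / (N : ℝ)) (1 / N)) : ℝ) / n < 2 / N := by
          have e : (2 : ℝ) / N = 1 / N + 1 / N := by ring
          linarith
        rw [div_lt_iff₀ hnR] at h'
        exact h'.le
    refine iSup₂_le fun s hs => iSup₂_le fun t ht => iSup₂_le fun hst hd =>
      ENNReal.ofReal_le_ofReal ?_
    have hYn : (fun i : Fin n => Y i ω) = fun i : Fin n => m (X i ω) + err i ω :=
      funext fun i => hY i ω
    rw [hYn]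
    have hδ1 : 1 / (N : ℝ) < 1 := by
      rw [div_lt_one hNR]; exact_mod_cast hN
    have key := hsample.abs_dart_sub_le hξ hn hE0 hσ.le hδ1 (hdiag n hnq) hmM hx hs ht hst hd
      hη hηκ hτ hR hB ha htune₂
    rw [← hG₀] at key
    -- The budget is `φ / 4` for the share of a small child, `φ / 4` for the logarithmic term and `φ
    -- / 2` for the comparison of losses.
    refine key.trans ?_
    linarith
  have hcover : ∀ᶠ n : ℕ in atTop, μ {ω | ENNReal.ofReal φ <
      DART.dartModulus k (DART.precision q L ρ n) (fun i : Fin n => X i ω)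
          (fun i : Fin n => Y i ω) x ε (1 / N)} ≤ ENNReal.ofReal π +
      (ENNReal.ofReal (C₂ * Real.exp (-c₂ * n)) + ∑ j, μ (B₄ n j) + ∑ j, μ (B₅ n j)
        + μ (B₆ n)) := by
    filter_upwards [hgood, eventually_gt_atTop n₀] with n hn hn₀
    have hsub : {ω | ENNReal.ofReal φ <
        DART.dartModulus k (DART.precision q L ρ n) (fun i : Fin n => X i ω)
          (fun i : Fin n => Y i ω) x ε (1 / N)} ⊆
        B₁ ∪ B₃ n ∪ (B₂ n ∪ (⋃ j, B₄ n j) ∪ (⋃ j, B₅ n j) ∪ B₆ n) := by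
      intro ω hω
      by_contra hno
      simp only [Set.mem_union, not_or] at hno
      obtain ⟨⟨h₁, h₃⟩, ⟨⟨h₂, h₄⟩, h₅⟩, h₆⟩ := hno
      exact absurd (hn ω h₁ h₂ h₃ h₄ h₅ h₆) (not_le.2 hω)
    have hm₁ : μ B₁ = 0 := DART.measure_exists_notMem_cube hXm hXunif
    have hm₂ : μ (B₂ n) ≤ ENNReal.ofReal (C₂ * Real.exp (-c₂ * n)) := by
      rw [← ofReal_measureReal]
      exact ENNReal.ofReal_le_ofReal (hsq n)
    have hm₃ : μ (B₃ n) ≤ ENNReal.ofReal π := by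
      rw [← ofReal_measureReal]
      refine ENNReal.ofReal_le_ofReal ?_
      have hmeas : MeasurableSet {ω | ∀ i < n, |err i ω| ≤ C * √(Real.log n)} := by
        have : {ω | ∀ i < n, |err i ω| ≤ C * √(Real.log n)} =
            ⋂ i, ⋂ (_ : i < n), {ω | |err i ω| ≤ C * √(Real.log n)} := by
          ext ω; simp
        rw [this]
        exact MeasurableSet.iInter fun i => MeasurableSet.iInter fun _ =>
          measurableSet_le (continuous_abs.measurable.comp (herrm i)) measurable_const
      rw [hB₃, probReal_compl_eq_one_sub hmeas]
      linarith [hmax n hn₀]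
    refine (measure_mono hsub).trans ((measure_union_le _ _).trans (add_le_add ?_ ?_))
    · refine (measure_union_le _ _).trans ?_
      rw [hm₁, zero_add]
      exact hm₃
    · refine (measure_union_le _ _).trans (add_le_add_left ?_ _)
      refine (measure_union_le _ _).trans (add_le_add ?_ (measure_iUnion_fintype_le _ _))
      exact (measure_union_le _ _).trans (add_le_add hm₂ (measure_iUnion_fintype_le _ _))
  have hrest : Tendsto (fun n : ℕ => ENNReal.ofReal π +
      (ENNReal.ofReal (C₂ * Real.exp (-c₂ * n)) + ∑ j, μ (B₄ n j) + ∑ j, μ (B₅ n j)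
        + μ (B₆ n))) atTop (nhds (ENNReal.ofReal π)) := by
    have t₂ : Tendsto (fun n : ℕ => ENNReal.ofReal (C₂ * Real.exp (-c₂ * n))) atTop (nhds 0) := by
      rw [← ENNReal.ofReal_zero]
      refine ENNReal.tendsto_ofReal ?_
      have h : Tendsto (fun n : ℕ => c₂ * (n : ℝ)) atTop atTop :=
        tendsto_natCast_atTop_atTop.const_mul_atTop hc₂
      have h' := (Real.tendsto_exp_neg_atTop_nhds_zero.comp h).const_mul C₂
      simpa [Function.comp_def, neg_mul] using h'
    have t₄ : Tendsto (fun n => ∑ j, μ (B₄ n j)) atTop (nhds 0) := by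
      have := tendsto_finsetSum (Finset.univ : Finset (Fin D → Fin N₁)) fun j _ =>
        DART.tendsto_measure_countIn hXm hXind hXunif (DART.measurableSet_gridCube j) hκ0
      simpa using this
    have t₅ : Tendsto (fun n => ∑ j, μ (B₅ n j)) atTop (nhds 0) := by
      have := tendsto_finsetSum (Finset.univ : Finset (Fin D × Fin (N + 1))) fun j _ =>
        DART.tendsto_measure_countIn hXm hXind hXunif
          (DART.measurableSet_slab j.1 ((j.2 : ℕ) / (N : ℝ)) (1 / N))
          (by positivity : 0 < 1 / (N : ℝ))
      rw [Finset.sum_const_zero] at this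
      exact this
    have t₆ : Tendsto (fun n => μ (B₆ n)) atTop (nhds 0) :=
      DART.tendsto_measure_box_sums hXm hindep htail_avg q (Option (Fin (k - 1)))
    have := tendsto_const_nhds (x := ENNReal.ofReal π) |>.add (((t₂.add t₄).add t₅).add t₆)
    simpa using this
  calc _ ≤ limsup (fun n : ℕ => ENNReal.ofReal π +
      (ENNReal.ofReal (C₂ * Real.exp (-c₂ * n)) + ∑ j, μ (B₄ n j) + ∑ j, μ (B₅ n j)
        + μ (B₆ n))) atTop := limsup_le_limsup hcover
    _ = ENNReal.ofReal π := hrest.limsup_eq
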